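/- Let $d\ge 1$, $M\ge 2$, and let $(X,Y)\sim\mathrm P$ on $\mathbb R^d\times\{1,\dots,M\}$, where $X$ is uniform on $[0,1]^d$ and $\pi_m:=\mathrm P(Y=m)>0$ for all $m$. Write $\eta_m(x)=\mathrm P(Y=m\mid X=x)$ and $\eta^w_m(x)=\frac{\eta_m(x)/\pi_m}{\sum_j \eta_j(x)/\pi_j}$, and let $\eta^w_{(1)}(x)\ge\eta^w_{(2)}(x)\ge\cdots$ be the decreasing rearrangement of $(\eta^w_m(x))_m$. Assume, for constants $\alpha,c_L,\beta,c_\beta>0$, (i) (Hölder smoothness) $|\eta_m(x')-\eta_m(x)|\le c_L\|x'-x\|_2^\alpha$ for all $x,x'\in[0,1]^d$ and all $m$; (ii) (margin) $\mathrm P\bigl(|\eta^w_{(1)}(X)-\eta^w_{(2)}(X)|\le t\bigr)\le c_\beta t^\beta$ for all $t>0$. For a classifier $f:\mathbb R^d\to\{1,\dots,M\}$ let $r_{\mathrm{AM}}(f)=\frac1M\sum_{m=1}^M \mathrm P(f(X)=m\mid Y=m)$ and let $\mathfrak R_{\mathrm{AM}}(f)=\sup_{g\text{ measurable}} r_{\mathrm{AM}}(g)-r_{\mathrm{AM}}(f)$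 be its AM-regret. Given an i.i.d. sample $D_n=((X_i,Y_i))_{i=1}^n$ from $\mathrm P$, let $n_{(m)}=\#\{i:Y_i=m\}$. Given $D_n$, accept each observation $i$ independently with probability $\min_j n_{(j)}/n_{(Y_i)}$ (under-sampling); let $D_n^u$ be the set of accepted observations and $s_u=\#D_n^u$. For $k\in\mathbb N$ put $\widehat\eta^{k,u}_m(x)=\frac1k\sum_{i=1}^k \mathbf 1\{Y^u_{(i)}(x)=m\}$, where $Y^u_{(i)}(x)$ is the label of the $i$-th nearest neighbour of $x$ in $D_n^u$ in the Euclidean distance. The under-sampling $k$-NN classifier is $\widehat f^{k,u}(x)\in\arg\max_m\widehat\eta_m^{k,u}(x)$, measurable in $x$; ties among neighbours and in the $\arg\max$ may be broken in any way. Then there are a constant $c>0$ and $N_1^*\in\mathbb N$, depending only on $d,M,\alpha,\beta,c_L,c_\beta$ and a positive lower bound for $\min_m\pi_m$, such that for all $n\ge N_1^*$ the following holds: if $$k=s_u^{2\alpha/(2\alpha+d)}(\log s_u)^{d/(2\alpha+d)},$$ rounded up or down to an integer, then $$\mathfrak R_{\mathrm{AM}}(\widehat f^{k,u})\le c\,\Bigl(\frac{\log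 n}{n}\Bigr)^{\alpha(\beta+1)/(2\alpha+d)}$$ with probability at least $1-4/n^2$ with respect to the joint law of $D_n$ and the acceptance indicators. -/

import Mathlib

open MeasureTheory ProbabilityTheory

namespace UnderSampling

noncomputable section

/-- The feature space `ℝ^d` with the Euclidean norm. -/
abbrev E (d : ℕ) : Type := EuclideanSpace ℝ (Fin d)

/-- The unit cube `[0,1]^d`. -/
def cube (d : ℕ) : Set (E d) := {x | ∀ i, x i ∈ Set.Icc (0 : ℝ) 1}

/-- The uniform distribution on `[0,1]^d`. -/
def uniformCube (d : ℕ) : Measure (E d) := volume.restrict (cube d)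

/-- The class probability `π_m = P(Y = m)`. -/
def classProb {d M : ℕ} (P : Measure (E d × Fin M)) (m : Fin M) : ℝ :=
  P.real {p | p.2 = m}

/-- The posterior probability `η_m(x) = P(Y = m | X = x)` read off a conditional law of `Y`
given `X`. -/
def posterior {d M : ℕ} (κ : Kernel (E d) (Fin M)) (x : E d) (m : Fin M) : ℝ :=
  (κ x).real {m}

/-- The weighted posterior probability `η^w_m(x)`. -/
def weightedPosterior {d M : ℕ} (P : Measure (E d × Fin M)) (κ : Kernel (E d) (Fin M))
    (x : E d) (m : Fin M) : ℝ :=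
  (posterior κ x m / classProb P m) / ∑ j, posterior κ x j / classProb P j

/-- The `(j+1)`-th largest entry of `v`, counted with multiplicity. -/
def orderStat {M : ℕ} (v : Fin M → ℝ) (j : Fin M) : ℝ := v (Tuple.sort v j.rev)

/-- `α`-Hölder continuity of the posterior probability function on `[0,1]^d`
(sup norm on `ℝ^M`, Euclidean norm on `ℝ^d`). -/
def HolderPosterior {d M : ℕ} (κ : Kernel (E d) (Fin M)) (α cL : ℝ) : Prop :=
  ∀ x ∈ cube d, ∀ x' ∈ cube d, ∀ m,
    |posterior κ x' m - posterior κ x m| ≤ cL * ‖x' - x‖ ^ α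

/-- The margin condition with exponent `β` and constant `cβ` for the weighted posterior. -/
def MarginCondition {d M : ℕ} (hM : 2 ≤ M) (P : Measure (E d × Fin M))
    (κ : Kernel (E d) (Fin M)) (β cβ : ℝ) : Prop :=
  ∀ t : ℝ, 0 < t →
    P.fst.real {x | |orderStat (weightedPosterior P κ x) ⟨0, by omega⟩
        - orderStat (weightedPosterior P κ x) ⟨1, by omega⟩| ≤ t} ≤ cβ * t ^ β

/-- The recall `P(f(x) = m | y = m)` of class `m`. -/
def classRecall {d M : ℕ} (P : Measure (E d × Fin M)) (f : E d → Fin M) (m : Fin M) : ℝ :=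
  (ProbabilityTheory.cond P {p | p.2 = m}).real {p | f p.1 = m}

/-- The AM measure: the arithmetic mean of the recalls. -/
def amMeasure {d M : ℕ} (P : Measure (E d × Fin M)) (f : E d → Fin M) : ℝ :=
  (1 / (M : ℝ)) * ∑ m, classRecall P f m

/-- The optimal AM performance over all measurable classifiers. -/
def optimalAM {d M : ℕ} (P : Measure (E d × Fin M)) : ℝ :=
  sSup {r | ∃ f : E d → Fin M, Measurable f ∧ r = amMeasure P f}

/-- The AM-regret. -/
def amRegret {d M : ℕ} (P : Measure (E d × Fin M)) (f : E d → Fin M) : ℝ :=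
  optimalAM P - amMeasure P f

/-- The number of observations with label `m`. -/
def classCount {d M n : ℕ} (D : Fin n → E d × Fin M) (m : Fin M) : ℕ :=
  (Finset.univ.filter fun i => (D i).2 = m).card

/-- The size of the minority class. -/
def minorityCount {d M n : ℕ} (D : Fin n → E d × Fin M) : ℕ := ⨅ m, classCount D m

/-- The acceptance probability of the `i`-th observation: the size of the minority class divided
by the size of the class of the observation. -/
def acceptProb {d M n : ℕ} (D : Fin n → E d × Fin M) (i : Fin n) : ℝ :=
  (minorityCount D : ℝ) / (classCount D (D i).2 : ℝ)

/-- Conditional probability, given the data `D`, of the acceptance pattern `z`: the indicators are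
independent and the `i`-th one is Bernoulli with parameter `acceptProb D i`. -/
def patternProb {d M n : ℕ} (D : Fin n → E d × Fin M) (z : Fin n → Bool) : ℝ :=
  ∏ i, if z i = true then acceptProb D i else 1 - acceptProb D i

/-- The joint law of the data (`n` independent draws from `P`) and of the acceptance indicators
(drawn given the data). -/
def samplingLaw {d M : ℕ} (P : Measure (E d × Fin M)) (n : ℕ) :
    Measure ((Fin n → E d × Fin M) × (Fin n → Bool)) :=
  ∑ z : Fin n → Bool,
    ((Measure.pi fun _ : Fin n => P).withDensity
      fun D => ENNReal.ofReal (patternProb D z)).map fun D => (D, z)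

/-- The indices of the accepted observations. -/
def accepted {n : ℕ} (z : Fin n → Bool) : Finset (Fin n) :=
  Finset.univ.filter fun i => z i = true

/-- `σ` lists the accepted observations by nondecreasing Euclidean distance to `x`, so that
`σ 0, σ 1, …` are the first, second, … nearest neighbours of `x` (ties in any order). -/
def IsNeighborOrder {d M n : ℕ} (D : Fin n → E d × Fin M) (A : Finset (Fin n)) (x : E d)
    (σ : Fin A.card ≃ {i // i ∈ A}) : Prop :=
  Monotone fun j => ‖(D (σ j)).1 - x‖

/-- The fraction of label `m` among the first `k` neighbours listed by `σ`. -/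
def posteriorEstimate {d M n : ℕ} (D : Fin n → E d × Fin M) (A : Finset (Fin n))
    (σ : Fin A.card ≃ {i // i ∈ A}) (k : ℕ) (m : Fin M) : ℝ :=
  (1 / (k : ℝ)) * ∑ j : Fin A.card, if (j : ℕ) < k ∧ (D (σ j)).2 = m then 1 else 0

/-- `f` is a `k`-nearest-neighbour classifier built on the observations with index in `A`:
at each `x` it returns a label that maximizes the posterior estimate (ties in any way). -/
def IsKNNClassifier {d M n : ℕ} (D : Fin n → E d × Fin M) (A : Finset (Fin n)) (k : ℕ)
    (f : E d → Fin M) : Prop :=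
  Measurable f ∧ ∀ x, ∃ σ : Fin A.card ≃ {i // i ∈ A}, IsNeighborOrder D A x σ ∧
    ∀ m, posteriorEstimate D A σ k m ≤ posteriorEstimate D A σ k (f x)

/-- The prescribed number of neighbours, before rounding, for a subsample of size `s`. -/
def neighborNumber (d : ℕ) (α : ℝ) (s : ℕ) : ℝ :=
  (s : ℝ) ^ (2 * α / (2 * α + d)) * Real.log s ^ ((d : ℝ) / (2 * α + d))

end

end UnderSampling

/-! Under-sampling makes the classes about equally frequent, so the vote among neighbours compares
the class densities `η_m / π_m`. The AM measure of `f` is `1 / M` times the mean of the class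
density at the chosen label (`amMeasure_eq`). If that density is within `t` of the maximum off a set
`B`, then wherever `f` errs off `B` the two largest weighted posteriors differ by at most `t`, and
the margin condition bounds the regret by `cβ * t ^ (β + 1) + P(B) / p₀` (`amRegret_le`). It remains
to get `t` of order `l = ρ ^ α`, where `ρ = (log n / n) ^ (1 / (2α + d))`, with `P(B) ≤ n ^ (-e)`
for the exponent `e` of the rate.

The stochastic input is an exponential moment. Given the labels, the accepted points of class `m` in
`S` are binomial, and their moment generating function is at most that of a Poisson variable with
mean (minority count) × P(X ∈ S | Y = m) (`lintegral_exp_acceptedCount_le`). Centring at this random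
intensity makes the bound hold for all labels at once. Chernoff's method with parameters `±l` and
level `L` gives a relative error `l` and an additive error `L / l`; for `L = K log n` and `T = n ρ ^
d`, the balance `T l ^ 2 = log n` turns the latter into `K T l`.

No bound uniform in `x` is needed. For fixed `x` a union bound covers the classes and a grid of
radii with mesh `1 / n`; Fubini and Markov then show that the bad points have small mass with high
probability (`measureReal_deviationSet_mass_ge`).

At a good `x`, the `k`-th neighbour is at distance at most of order `ρ`. The count of the chosen
label in a grid ball reaching that neighbour is at least the count of any label in the ball one mesh
smaller. Replacing counts by intensities, paying `O(1 / n)` for the shell, and using Hölder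
continuity bounds the density gap by a multiple of `l` (`classDensity_sub_le_of_counts`). -/

namespace UnderSampling

/-! ### Labels, counts and acceptance ratios. -/

/-- The labels of a data set. -/
def labels {d M n : ℕ} (D : Fin n → E d × Fin M) : Fin n → Fin M := fun i => (D i).2

/-- A data set with prescribed labels and all features at the origin. -/
def ofLabels (d : ℕ) {M n : ℕ} (y : Fin n → Fin M) : Fin n → E d × Fin M := fun i => (0, y i)

/-- The probability of `X ∈ S` given `Y = m`. -/
noncomputable def classMeasure {d M : ℕ} (P : Measure (E d × Fin M)) (m : Fin M)
    (S : Set (E d)) : ℝ :=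
  P.real {p | p.1 ∈ S ∧ p.2 = m} / classProb P m

open Classical in
/-- The number of accepted observations with label `m` and feature in `S`. -/
noncomputable def acceptedCount {d M n : ℕ} (D : Fin n → E d × Fin M) (A : Finset (Fin n))
    (m : Fin M) (S : Set (E d)) : ℕ :=
  (A.filter fun i => (D i).1 ∈ S ∧ (D i).2 = m).card

variable {d M n : ℕ}

lemma measurable_labels : Measurable (labels : (Fin n → E d × Fin M) → _) :=
  measurable_pi_lambda _ fun i => measurable_snd.comp (measurable_pi_apply i)

lemma measurable_of_labels {γ : Type*} [MeasurableSpace γ] (g : (Fin n → Fin M) → γ) :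
    Measurable fun D : Fin n → E d × Fin M => g (labels D) :=
  (measurable_of_finite g).comp measurable_labels

lemma classCount_ofLabels (D : Fin n → E d × Fin M) (m : Fin M) :
    classCount (ofLabels d (labels D)) m = classCount D m := rfl

lemma minorityCount_ofLabels (D : Fin n → E d × Fin M) :
    minorityCount (ofLabels d (labels D)) = minorityCount D := rfl

lemma minorityCount_le_classCount (D : Fin n → E d × Fin M) (m : Fin M) :
    minorityCount D ≤ classCount D m := ciInf_le (OrderBot.bddBelow _) m

lemma classCount_le (D : Fin n → E d × Fin M) (m : Fin M) : classCount D m ≤ n :=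
  (Finset.card_filter_le _ _).trans (by simp)

lemma ratio_nonneg (D : Fin n → E d × Fin M) (m : Fin M) :
    0 ≤ (minorityCount D : ℝ) / classCount D m := by positivity

lemma ratio_le_one (D : Fin n → E d × Fin M) (m : Fin M) :
    (minorityCount D : ℝ) / classCount D m ≤ 1 :=
  div_le_one_of_le₀ (by exact_mod_cast minorityCount_le_classCount D m) (by positivity)

lemma ratio_mul_classCount (D : Fin n → E d × Fin M) (m : Fin M) :
    (minorityCount D : ℝ) / classCount D m * classCount D m = minorityCount D := by
  -- An empty class forces the minority count to vanish too, so `0 / 0 = 0` is harmless.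
  rcases Nat.eq_zero_or_pos (classCount D m) with h | h
  · have := minorityCount_le_classCount D m
    have h0 : minorityCount D = 0 := by omega
    simp [h0]
  · field_simp

lemma patternProb_nonneg (D : Fin n → E d × Fin M) (z : Fin n → Bool) : 0 ≤ patternProb D z := by
  refine Finset.prod_nonneg fun i _ => ?_
  split_ifs
  · exact ratio_nonneg D _
  · exact sub_nonneg.2 (ratio_le_one D _)

lemma measurable_patternProb (z : Fin n → Bool) :
    Measurable fun D : Fin n → E d × Fin M => patternProb D z :=
  measurable_of_labels fun y => patternProb (ofLabels d y) z

/-! ### Integration against the sampling law. -/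

/-- Integration against a product measure, decomposed according to the labels. -/
lemma integral_labels_prod (P : Measure (E d × Fin M)) [IsProbabilityMeasure P]
    (g : (Fin n → Fin M) → ℝ) (h : (Fin n → Fin M) → Fin n → E d × Fin M → ℝ)
    (hi : ∀ y i, Integrable (h y i) P) :
    Integrable (fun D => g (labels D) * ∏ i, h (labels D) i (D i)) (Measure.pi fun _ => P) ∧
    ∫ D, g (labels D) * ∏ i, h (labels D) i (D i) ∂(Measure.pi fun _ => P)
      = ∑ y, g y * ∏ i, ∫ p in {p | p.2 = y i}, h y i p ∂P := by
  have hm : ∀ m : Fin M, MeasurableSet {p : E d × Fin M | p.2 = m} := fun m =>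
    measurable_snd (measurableSet_singleton m)
  -- Only the label vector of `D` itself survives in the sum. Once `y` is fixed, each summand is a
  -- product of functions of single observations.
  have key : (fun D : Fin n → E d × Fin M => g (labels D) * ∏ i, h (labels D) i (D i))
      = fun D => ∑ y, g y * ∏ i, Set.indicator {p : E d × Fin M | p.2 = y i} (h y i) (D i) := by
    funext D
    rw [Finset.sum_eq_single (labels D)]
    · congr 1
      exact Finset.prod_congr rfl fun i _ => (Set.indicator_of_mem (by rfl) _).symm
    · intro y _ hy
      obtain ⟨i, hi⟩ : ∃ i, y i ≠ labels D i := Function.ne_iff.1 hy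
      rw [Finset.prod_eq_zero (Finset.mem_univ i), mul_zero]
      exact Set.indicator_of_notMem (fun h => hi h.symm) _
    · simp
  have hI : ∀ y : Fin n → Fin M, Integrable (fun D : Fin n → E d × Fin M =>
      g y * ∏ i, Set.indicator {p : E d × Fin M | p.2 = y i} (h y i) (D i))
      (Measure.pi fun _ => P) := fun y =>
    (Integrable.fintype_prod fun i => (hi y i).indicator (hm _)).const_mul _
  rw [key]
  refine ⟨integrable_finsetSum _ fun y _ => hI y, ?_⟩
  rw [integral_finsetSum _ fun y _ => hI y]
  refine Finset.sum_congr rfl fun y _ => ?_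
  rw [integral_const_mul, integral_fintype_prod_eq_prod]
  simp_rw [integral_indicator (hm _)]

lemma lintegral_samplingLaw (P : Measure (E d × Fin M))
    (F : (Fin n → E d × Fin M) × (Fin n → Bool) → ENNReal) (hF : Measurable F) :
    ∫⁻ ω, F ω ∂(samplingLaw P n) = ∫⁻ D, ∑ z, ENNReal.ofReal (patternProb D z) * F (D, z)
      ∂(Measure.pi fun _ => P) := by
  have hp : ∀ z : Fin n → Bool, Measurable fun D : Fin n → E d × Fin M => (D, z) := fun z =>
    measurable_prodMk_right
  rw [samplingLaw, lintegral_finsetSum_measure, lintegral_finsetSum]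
  · refine Finset.sum_congr rfl fun z _ => ?_
    rw [lintegral_map hF (hp z)]
    exact lintegral_withDensity_eq_lintegral_mul _ (measurable_patternProb z).ennreal_ofReal
        (hF.comp (hp z))
  · exact fun z _ => (measurable_patternProb z).ennreal_ofReal.mul (hF.comp (hp z))

lemma sum_prod_bool (f : Fin n → Bool → ℝ) :
    ∑ z : Fin n → Bool, ∏ i, f i (z i) = ∏ i, (f i true + f i false) := by
  have := Finset.prod_univ_sum (fun _ : Fin n => (Finset.univ : Finset Bool)) f
  simp only [Fintype.piFinset_univ, Fintype.sum_bool] at this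
  exact this.symm

-- Acceptances are independent given the data, so the moment factors over the observations; only
-- those with label `m` and feature in `S` give a nontrivial Bernoulli factor.
open Classical in
lemma sum_patternProb_mul_exp (D : Fin n → E d × Fin M) (m : Fin M) (S : Set (E d)) (l : ℝ) :
    ∑ z, patternProb D z * Real.exp (l * acceptedCount D (accepted z) m S)
      = ∏ i, (1 + (minorityCount D : ℝ) / classCount D m * (Real.exp l - 1) *
          Set.indicator {p : E d × Fin M | p.1 ∈ S ∧ p.2 = m} 1 (D i)) := by
  have h1 : ∀ z : Fin n → Bool, patternProb D z * Real.exp (l * acceptedCount D (accepted z) m S)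
      = ∏ i, ((if z i = true then acceptProb D i else 1 - acceptProb D i) *
        if z i = true ∧ ((D i).1 ∈ S ∧ (D i).2 = m) then Real.exp l else 1) := by
    intro z
    rw [Finset.prod_mul_distrib, ← Finset.prod_filter, Finset.prod_const, ← Real.exp_nat_mul,
      mul_comm _ l, acceptedCount, accepted, Finset.filter_filter]
    rfl
  simp_rw [h1]
  rw [sum_prod_bool fun i b => ((if b = true then acceptProb D i else 1 - acceptProb D i) *
        if b = true ∧ ((D i).1 ∈ S ∧ (D i).2 = m) then Real.exp l else 1)]
  refine Finset.prod_congr rfl fun i _ => ?_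
  by_cases h : (D i).1 ∈ S ∧ (D i).2 = m
  · simp [h, acceptProb]; ring
  · simp [h]

lemma sum_patternProb (D : Fin n → E d × Fin M) : ∑ z, patternProb D z = 1 := by
  simp only [patternProb]
  rw [sum_prod_bool fun i b => (if b = true then acceptProb D i else 1 - acceptProb D i)]
  simp

instance (P : Measure (E d × Fin M)) [IsProbabilityMeasure P] :
    IsProbabilityMeasure (samplingLaw P n) := by
  constructor
  rw [← lintegral_one, lintegral_samplingLaw P _ measurable_const]
  simp only [mul_one]
  simp_rw [← ENNReal.ofReal_sum_of_nonneg fun z _ => patternProb_nonneg _ z, sum_patternProb]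
  simp

/-- The set may move with a parameter. With the centre of a ball as parameter, this gives the joint
measurability that Fubini requires. -/
lemma measurable_acceptedCount_of_prod {γ : Type*} [MeasurableSpace γ] (m : Fin M)
    {T : Set (γ × E d)} (hT : MeasurableSet T) :
    Measurable fun q : ((Fin n → E d × Fin M) × (Fin n → Bool)) × γ =>
      (acceptedCount q.1.1 (accepted q.1.2) m {y | (q.2, y) ∈ T} : ℝ) := by
  classical
  have : (fun q : ((Fin n → E d × Fin M) × (Fin n → Bool)) × γ =>
      (acceptedCount q.1.1 (accepted q.1.2) m {y | (q.2, y) ∈ T} : ℝ)) =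
      fun q => ∑ i, if q.1.2 i = true ∧
        ((q.2, (q.1.1 i).1) ∈ T ∧ (q.1.1 i).2 = m) then (1 : ℝ) else 0 := by
    funext q
    rw [acceptedCount, accepted, Finset.filter_filter, Finset.card_filter]
    push_cast
    rfl
  rw [this]
  have hs : ∀ i, MeasurableSet {q : ((Fin n → E d × Fin M) × (Fin n → Bool)) × γ |
      q.1.2 i = true ∧ ((q.2, (q.1.1 i).1) ∈ T ∧ (q.1.1 i).2 = m)} := by
    intro i
    have h1 : Measurable fun q : ((Fin n → E d × Fin M) × (Fin n → Bool)) × γ => q.1.1 i :=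
      (measurable_pi_apply i).comp (measurable_fst.comp measurable_fst)
    have h2 : Measurable fun q : ((Fin n → E d × Fin M) × (Fin n → Bool)) × γ => q.1.2 i :=
      (measurable_pi_apply i).comp (measurable_snd.comp measurable_fst)
    have h3 : Measurable fun q : ((Fin n → E d × Fin M) × (Fin n → Bool)) × γ =>
      (q.2, (q.1.1 i).1) := measurable_snd.prodMk (measurable_fst.comp h1)
    have h4 : Measurable fun q : ((Fin n → E d × Fin M) × (Fin n → Bool)) × γ => (q.1.1 i).2 :=
      measurable_snd.comp h1
    exact (h2 (measurableSet_singleton true)).inter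
      ((h3 hT).inter (h4 (measurableSet_singleton m)))
  exact Finset.measurable_sum _ fun i _ => Measurable.ite (hs i) measurable_const measurable_const

lemma measurable_acceptedCount (m : Fin M) {S : Set (E d)} (hS : MeasurableSet S) :
    Measurable fun ω : (Fin n → E d × Fin M) × (Fin n → Bool) =>
      (acceptedCount ω.1 (accepted ω.2) m S : ℝ) := by
  have h := (measurable_acceptedCount_of_prod (n := n) m
    (measurable_snd hS : MeasurableSet ((Prod.snd : Unit × E d → E d) ⁻¹' S))).comp
    (measurable_prodMk_right (y := ()))
  simpa only [Function.comp_def, Set.mem_preimage, Set.ofPred_mem_eq] using h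

lemma measurable_minorityCount :
    Measurable fun ω : (Fin n → E d × Fin M) × (Fin n → Bool) => (minorityCount ω.1 : ℝ) :=
  (measurable_of_labels fun y => (minorityCount (ofLabels d y) : ℝ)).comp measurable_fst

/-! ### Exponential moments of the counts. -/

lemma sum_classProb (P : Measure (E d × Fin M)) [IsProbabilityMeasure P] :
    ∑ m, classProb P m = 1 := by
  have hm : ∀ m : Fin M, MeasurableSet {p : E d × Fin M | p.2 = m} := fun m =>
    measurable_snd (measurableSet_singleton m)
  simp only [classProb]
  rw [← measureReal_iUnion_fintype _ hm, ← probReal_univ (μ := P)]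
  · congr 1
    ext p; simp
  · exact fun i j hij => Set.disjoint_left.2 fun p hp hp' => hij (hp.symm.trans hp')

lemma classMeasure_nonneg (P : Measure (E d × Fin M)) (m : Fin M) (S : Set (E d)) :
    0 ≤ classMeasure P m S := div_nonneg measureReal_nonneg measureReal_nonneg

lemma classMeasure_le_one (P : Measure (E d × Fin M)) [IsProbabilityMeasure P] (m : Fin M)
    (S : Set (E d)) : classMeasure P m S ≤ 1 :=
  div_le_one_of_le₀ (measureReal_mono fun _ h => h.2) measureReal_nonneg

lemma prod_indicator_label (y : Fin n → Fin M) (m : Fin M) (a : ℝ) :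
    ∏ i, (1 + a * if y i = m then 1 else 0) = (1 + a) ^ classCount (ofLabels d y) m := by
  have : ∀ i, (1 + a * if y i = m then 1 else 0) = if y i = m then 1 + a else 1 := by
    intro i; split_ifs <;> simp
  simp_rw [this]
  rw [← Finset.prod_filter, Finset.prod_const]
  rfl

/-- The exponential moment of the number of accepted observations in a class and a set, normalized
by the exponential of its conditional intensity, is at most one. -/
theorem lintegral_exp_acceptedCount_le (P : Measure (E d × Fin M)) [IsProbabilityMeasure P]
    (m : Fin M) (hpos : 0 < classProb P m) {S : Set (E d)} (hS : MeasurableSet S) (l : ℝ) :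
    ∫⁻ ω, ENNReal.ofReal (Real.exp (l * acceptedCount ω.1 (accepted ω.2) m S
      - minorityCount ω.1 * ((Real.exp l - 1) * classMeasure P m S))) ∂(samplingLaw P n) ≤ 1 := by
  have hlab : ∀ m : Fin M, MeasurableSet {p : E d × Fin M | p.2 = m} := fun m =>
    measurable_snd (measurableSet_singleton m)
  have hSm : MeasurableSet {p : E d × Fin M | p.1 ∈ S ∧ p.2 = m} :=
    (measurable_fst hS).inter (hlab m)
  set w := (Real.exp l - 1) * classMeasure P m S with hw
  have hw1 : -1 ≤ w := by
    -- The bound `-1 ≤ w` keeps `1 + r y * w` nonnegative, so that it can be raised to a power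
    -- monotonically below.
    have h1 := classMeasure_nonneg P m S
    have h2 := classMeasure_le_one P m S
    nlinarith [Real.exp_pos l]
  set r : (Fin n → Fin M) → ℝ := fun y =>
    (minorityCount (ofLabels d y) : ℝ) / classCount (ofLabels d y) m with hr
  set h : (Fin n → Fin M) → Fin n → E d × Fin M → ℝ := fun y _ p =>
    1 + r y * (Real.exp l - 1) * Set.indicator {p : E d × Fin M | p.1 ∈ S ∧ p.2 = m} 1 p with hh
  set g : (Fin n → Fin M) → ℝ := fun y => Real.exp (-(minorityCount (ofLabels d y) * w)) with hg
  have hint : ∀ c : ℝ, Integrable (fun p : E d × Fin M => c *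
      Set.indicator {p : E d × Fin M | p.1 ∈ S ∧ p.2 = m} (1 : E d × Fin M → ℝ) p) P := fun c =>
    ((integrable_const (1 : ℝ)).indicator hSm).const_mul c
  have hi : ∀ y i, Integrable (h y i) P := fun y i => (integrable_const 1).add (hint _)
  obtain ⟨hI, hE⟩ := integral_labels_prod P g h hi
  have hpt : ∀ D : Fin n → E d × Fin M, ∑ z, ENNReal.ofReal (patternProb D z) *
      ENNReal.ofReal (Real.exp (l * acceptedCount D (accepted z) m S - minorityCount D * w))
      = ENNReal.ofReal (g (labels D) * ∏ i, h (labels D) i (D i)) := by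
    intro D
    simp_rw [← ENNReal.ofReal_mul (patternProb_nonneg D _)]
    rw [← ENNReal.ofReal_sum_of_nonneg fun z _ =>
      mul_nonneg (patternProb_nonneg D z) (Real.exp_pos _).le]
    congr 1
    simp only [hh, hr, hg, classCount_ofLabels, minorityCount_ofLabels]
    rw [← sum_patternProb_mul_exp, Finset.mul_sum]
    refine Finset.sum_congr rfl fun z _ => ?_
    rw [sub_eq_add_neg, Real.exp_add]; ring
  have hnn : ∀ D : Fin n → E d × Fin M, 0 ≤ g (labels D) * ∏ i, h (labels D) i (D i) := by
    intro D
    simp only [hh, hr, hg, classCount_ofLabels, minorityCount_ofLabels]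
    rw [← sum_patternProb_mul_exp]
    exact mul_nonneg (Real.exp_pos _).le (Finset.sum_nonneg fun z _ =>
      mul_nonneg (patternProb_nonneg D z) (Real.exp_pos _).le)
  rw [lintegral_samplingLaw]
  swap
  · exact ((((measurable_acceptedCount m hS).const_mul l).sub
      (measurable_minorityCount.mul_const w)).exp).ennreal_ofReal
  simp_rw [hpt]
  rw [← ofReal_integral_eq_lintegral_ofReal hI (ae_of_all _ hnn), hE, ← ENNReal.ofReal_one]
  refine ENNReal.ofReal_le_ofReal ?_
  have hset : ∀ (y : Fin n → Fin M) (i : Fin n), ∫ p in {p | p.2 = y i}, h y i p ∂P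
      = classProb P (y i) * (1 + r y * w * if y i = m then 1 else 0) := by
    intro y i
    simp only [hh]
    rw [integral_add (integrable_const _) (hint _).integrableOn, integral_const_mul,
      integral_indicator_one hSm, setIntegral_const, smul_eq_mul, mul_one,
      measureReal_restrict_apply hSm, mul_add]
    congr 1
    · simp [classProb]
    split_ifs with hy
    · have : {p : E d × Fin M | p.1 ∈ S ∧ p.2 = m} ∩ {p | p.2 = y i}
          = {p : E d × Fin M | p.1 ∈ S ∧ p.2 = m} := by
        ext p; simp [hy]
      rw [this, hw, classMeasure, hy]
      field_simp
    · have : {p : E d × Fin M | p.1 ∈ S ∧ p.2 = m} ∩ {p | p.2 = y i} = ∅ := by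
        ext p
        simp only [Set.mem_inter_iff, Set.mem_ofPred_eq, Set.mem_empty_iff_false, iff_false]
        rintro ⟨⟨_, h1⟩, h2⟩
        exact hy (h2.symm.trans h1)
      simp [this]
  calc ∑ y, g y * ∏ i, ∫ p in {p | p.2 = y i}, h y i p ∂P
      ≤ ∑ y : Fin n → Fin M, ∏ i, classProb P (y i) := by
        refine Finset.sum_le_sum fun y _ => ?_
        simp_rw [hset]
        rw [Finset.prod_mul_distrib, prod_indicator_label (d := d)]
        have hr0 : 0 ≤ r y := ratio_nonneg _ _
        have hr1 : r y ≤ 1 := ratio_le_one _ _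
        -- By `1 + u ≤ exp u` the binomial moment is at most a Poisson one. The class size cancels
        -- against the acceptance ratio, leaving the minority count that `g` compensates.
        have h1 : (1 + r y * w) ^ classCount (ofLabels d y) m
            ≤ Real.exp (minorityCount (ofLabels d y) * w) := by
          calc _ ≤ Real.exp (r y * w) ^ classCount (ofLabels d y) m :=
                pow_le_pow_left₀ (by nlinarith) (by linarith [Real.add_one_le_exp (r y * w)]) _
            _ = _ := by
                rw [← Real.exp_nat_mul, ← ratio_mul_classCount (ofLabels d y) m]
                congr 1; simp only [hr]; ring
        have h2 : 0 ≤ ∏ i, classProb P (y i) := Finset.prod_nonneg fun i _ => measureReal_nonneg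
        calc _ ≤ g y * ((∏ i, classProb P (y i)) * Real.exp (minorityCount (ofLabels d y) * w)) := by
              have := (Real.exp_pos (-(minorityCount (ofLabels d y) * w))).le
              simp only [hg]
              gcongr
          _ = _ := by
              simp only [hg]
              rw [mul_left_comm, ← Real.exp_add]; simp
    _ = 1 := by
        have := Finset.prod_univ_sum (fun _ : Fin n => (Finset.univ : Finset (Fin M)))
          (fun _ m => classProb P m)
        simp only [Fintype.piFinset_univ] at this
        rw [← this]
        simp [sum_classProb]

/-- The lower tail of the number of observations in a class. -/
theorem lintegral_exp_classCount_le (P : Measure (E d × Fin M)) [IsProbabilityMeasure P]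
    (m : Fin M) (l : ℝ) :
    ∫⁻ ω, ENNReal.ofReal (Real.exp (l * classCount ω.1 m)) ∂(samplingLaw P n)
      ≤ ENNReal.ofReal (Real.exp (n * (classProb P m * (Real.exp l - 1)))) := by
  have hlab : ∀ m : Fin M, MeasurableSet {p : E d × Fin M | p.2 = m} := fun m =>
    measurable_snd (measurableSet_singleton m)
  rw [lintegral_samplingLaw]
  swap
  · exact ((measurable_of_labels fun y => Real.exp
      (l * classCount (ofLabels d y) m)).comp measurable_fst).ennreal_ofReal
  have hpt : ∀ D : Fin n → E d × Fin M, ∑ z, ENNReal.ofReal (patternProb D z) *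
      ENNReal.ofReal (Real.exp (l * classCount D m))
      = ENNReal.ofReal (1 * ∏ i, (1 + (Real.exp l - 1) *
          Set.indicator {p : E d × Fin M | p.2 = m} 1 (D i))) := by
    intro D
    rw [← Finset.sum_mul, ← ENNReal.ofReal_sum_of_nonneg fun z _ => patternProb_nonneg D z,
      sum_patternProb, ENNReal.ofReal_one, one_mul, one_mul]
    congr 1
    have := prod_indicator_label (d := d) (labels D) m (Real.exp l - 1)
    rw [mul_comm l, Real.exp_nat_mul, ← classCount_ofLabels]
    simp only [add_sub_cancel] at this
    rw [← this]
    refine Finset.prod_congr rfl fun i _ => ?_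
    by_cases hD : (D i).2 = m <;> simp [hD, labels]
  have hint : Integrable (fun p : E d × Fin M => (Real.exp l - 1) *
      Set.indicator {p : E d × Fin M | p.2 = m} (1 : E d × Fin M → ℝ) p) P :=
    ((integrable_const (1 : ℝ)).indicator (hlab m)).const_mul _
  have hi : Integrable (fun p : E d × Fin M => 1 + (Real.exp l - 1) *
      Set.indicator {p : E d × Fin M | p.2 = m} (1 : E d × Fin M → ℝ) p) P :=
    (integrable_const (μ := P) (1 : ℝ)).add hint
  simp_rw [hpt]
  simp only [one_mul]
  rw [← ofReal_integral_eq_lintegral_ofReal (Integrable.fintype_prod fun i => hi)]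
  · refine ENNReal.ofReal_le_ofReal ?_
    have := integral_fintype_prod_eq_pow (ι := Fin n) (μ := P) (fun p => (1 + (Real.exp l - 1) *
          Set.indicator {p : E d × Fin M | p.2 = m} (1 : E d × Fin M → ℝ) p))
    rw [this, integral_add (integrable_const _) hint, integral_const_mul,
      integral_indicator_one (hlab m), Real.exp_nat_mul, Fintype.card_fin]
    have hc : P.real {p : E d × Fin M | p.2 = m} = classProb P m := rfl
    have h1 : classProb P m ≤ 1 := measureReal_le_one
    have h0 : 0 ≤ classProb P m := measureReal_nonneg
    rw [hc]
    simp only [integral_const, probReal_univ, smul_eq_mul, mul_one]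
    refine pow_le_pow_left₀ ?_ ?_ _
    · nlinarith [Real.exp_pos l]
    · have := Real.add_one_le_exp (classProb P m * (Real.exp l - 1))
      linarith
  · refine ae_of_all _ fun D => Finset.prod_nonneg fun i _ => ?_
    by_cases hD : (D i).2 = m <;> simp [hD, (Real.exp_pos l).le]

/-! ### Neighbours and counts in balls. -/

lemma card_filter_neighborOrder {A : Finset (Fin n)} (σ : Fin A.card ≃ {i // i ∈ A})
    (p : Fin n → Prop) [DecidablePred p] :
    (A.filter p).card = (Finset.univ.filter fun j => p (σ j)).card := by
  rw [Finset.card_filter, Finset.card_filter, ← Finset.sum_coe_sort]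
  exact (Equiv.sum_comp σ fun i : {i // i ∈ A} => if p i then 1 else 0).symm

lemma acceptedCount_mono (D : Fin n → E d × Fin M) (A : Finset (Fin n)) (m : Fin M)
    {S S' : Set (E d)} (h : S ⊆ S') : acceptedCount D A m S ≤ acceptedCount D A m S' := by
  classical
  exact Finset.card_le_card fun i hi => by
    simp only [Finset.mem_filter] at hi ⊢
    exact ⟨hi.1, h hi.2.1, hi.2.2⟩

open Classical in
lemma sum_acceptedCount (D : Fin n → E d × Fin M) (A : Finset (Fin n)) (S : Set (E d)) :
    ∑ m, acceptedCount D A m S = (A.filter fun i => (D i).1 ∈ S).card := by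
  rw [Finset.card_eq_sum_card_fiberwise (f := fun i => (D i).2) (t := Finset.univ) (by simp)]
  refine Finset.sum_congr rfl fun m _ => ?_
  rw [acceptedCount, Finset.filter_filter]

lemma acceptedCount_le_card (D : Fin n → E d × Fin M) (A : Finset (Fin n)) (m : Fin M)
    (S : Set (E d)) : acceptedCount D A m S ≤ A.card := by
  classical
  exact Finset.card_filter_le _ _

open Classical in
/-- The class counts among the first `k` neighbours are sandwiched between the counts in the open
and in the closed ball whose radius is the distance to the `k`-th neighbour. -/
lemma exists_neighbor_radius {D : Fin n → E d × Fin M} {A : Finset (Fin n)} {x : E d}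
    {σ : Fin A.card ≃ {i // i ∈ A}} (hσ : IsNeighborOrder D A x σ) {k : ℕ} (hk : 1 ≤ k) {r : ℝ}
    (hr : k ≤ ∑ m, acceptedCount D A m (Metric.closedBall x r)) :
    ∃ R, 0 ≤ R ∧ R ≤ r ∧ k ≤ ∑ m, acceptedCount D A m (Metric.closedBall x R) ∧ ∀ m,
      (acceptedCount D A m (Metric.ball x R) : ℝ) ≤ k * posteriorEstimate D A σ k m ∧
      k * posteriorEstimate D A σ k m ≤ acceptedCount D A m (Metric.closedBall x R) := by
  rw [sum_acceptedCount] at hr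
  have hkA : k ≤ A.card := hr.trans (Finset.card_filter_le _ _)
  have hlt : ∀ k' : ℕ, k' ≤ A.card → (Finset.univ.filter fun j : Fin A.card => (j : ℕ) < k').card = k' := by
    intro k' hk'
    rw [Fin.card_filter_val_lt]
    exact min_eq_right hk'
  -- Ranks start at zero, so this is the `k`-th neighbour; its distance to `x` is the radius `R`.
  set j₀ : Fin A.card := ⟨k - 1, by omega⟩ with hj₀
  have hest : ∀ m, k * posteriorEstimate D A σ k m
      = ((Finset.univ.filter fun j : Fin A.card => (j : ℕ) < k ∧ (D (σ j)).2 = m).card : ℝ) := by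
    intro m
    have : (k : ℝ) ≠ 0 := by positivity
    rw [posteriorEstimate, Finset.card_filter]
    push_cast
    field_simp
  have hd : ∀ j, dist (D (σ j)).1 x = ‖(D (σ j)).1 - x‖ := fun j => dist_eq_norm _ _
  refine ⟨‖(D (σ j₀)).1 - x‖, norm_nonneg _, ?_, ?_, fun m => ⟨?_, ?_⟩⟩
  · by_contra! hcon
    rw [card_filter_neighborOrder σ] at hr
    have : (Finset.univ.filter fun j => (D (σ j)).1 ∈ Metric.closedBall x r)
        ⊆ Finset.univ.filter fun j : Fin A.card => (j : ℕ) < k - 1 := by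
      intro j hj
      simp only [Finset.mem_filter, Finset.mem_univ, true_and, Metric.mem_closedBall, hd] at hj ⊢
      by_contra! h
      have : j₀ ≤ j := h
      exact absurd ((hσ this).trans hj) (not_le.2 hcon)
    have := Finset.card_le_card this
    rw [hlt _ (by omega)] at this
    omega
  · rw [sum_acceptedCount, card_filter_neighborOrder σ]
    conv_lhs => rw [← hlt k hkA]
    refine Finset.card_le_card fun j hj => ?_
    simp only [Finset.mem_filter, Finset.mem_univ, true_and, Metric.mem_closedBall, hd] at hj ⊢
    exact hσ (show j ≤ j₀ from Nat.le_sub_one_of_lt hj)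
  · rw [hest, acceptedCount, card_filter_neighborOrder σ]
    refine Nat.cast_le.2 (Finset.card_le_card fun j hj => ?_)
    simp only [Finset.mem_filter, Finset.mem_univ, true_and, Metric.mem_ball, hd] at hj ⊢
    refine ⟨?_, hj.2⟩
    by_contra! h
    have : j₀ ≤ j := show k - 1 ≤ (j : ℕ) by omega
    exact absurd (hσ this) (not_le.2 hj.1)
  · rw [hest, acceptedCount, card_filter_neighborOrder σ]
    refine Nat.cast_le.2 (Finset.card_le_card fun j hj => ?_)
    simp only [Finset.mem_filter, Finset.mem_univ, true_and, Metric.mem_closedBall, hd] at hj ⊢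
    exact ⟨hσ (show j ≤ j₀ from Nat.le_sub_one_of_lt hj.1), hj.2⟩

/-! ### Volumes of balls in the cube. -/

lemma measurableSet_cube : MeasurableSet (cube d) := by
  have : cube d = ⋂ i, {x : E d | x i ∈ Set.Icc (0 : ℝ) 1} := by ext; simp [cube]
  rw [this]
  exact MeasurableSet.iInter fun i =>
    (by fun_prop : Measurable fun x : E d => x i) measurableSet_Icc

/-- A ball centred in the cube with radius at most `1/2` meets the cube in volume at least
`(r/d)^d`. -/
lemma le_uniformCube_closedBall (hd : 1 ≤ d) {x : E d} (hx : x ∈ cube d) {r : ℝ} (hr : 0 ≤ r)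
    (hr' : r ≤ 1 / 2) [IsFiniteMeasure (uniformCube d)] :
    (r / d) ^ d ≤ (uniformCube d).real (Metric.closedBall x r) := by
  have hd' : (1 : ℝ) ≤ d := by exact_mod_cast hd
  set t := r / d with ht
  have ht0 : 0 ≤ t := by positivity
  have ht1 : t ≤ 1 / 2 := (div_le_self hr hd').trans hr'
  -- A box of side `r / d` with a corner at `x`, pointing inward in each coordinate: it stays in the
  -- unit cube since `t ≤ 1 / 2`, and in the ball since its diameter is `√d * t ≤ r`.
  set a : Fin d → ℝ := fun i => if x i ≤ 1 / 2 then x i else x i - t with ha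
  set S : Set (E d) := {y | (y : Fin d → ℝ) ∈ Set.Icc a (fun i => a i + t)} with hS
  have hpre : S = (WithLp.ofLp : E d → (Fin d → ℝ)) ⁻¹' Set.Icc a (fun i => a i + t) := rfl
  have hvol : volume S = ENNReal.ofReal (t ^ d) := by
    rw [hpre, (PiLp.volume_preserving_ofLp (Fin d)).measure_preimage
      measurableSet_Icc.nullMeasurableSet, Real.volume_Icc_pi]
    simp [ENNReal.ofReal_pow ht0]
  have hsub : S ⊆ Metric.closedBall x r ∩ cube d := by
    intro y hy
    have hy' : ∀ i, a i ≤ y i ∧ y i ≤ a i + t := fun i => ⟨hy.1 i, hy.2 i⟩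
    have hxi := fun i => hx i
    refine ⟨?_, fun i => ?_⟩
    · rw [Metric.mem_closedBall, EuclideanSpace.dist_eq]
      refine Real.sqrt_le_iff.2 ⟨hr, ?_⟩
      have h1 : ∀ i, dist (y i) (x i) ^ 2 ≤ t ^ 2 := by
        intro i
        refine pow_le_pow_left₀ dist_nonneg ?_ 2
        rw [Real.dist_eq, abs_le]
        have := hy' i
        simp only [ha] at this
        split_ifs at this <;> constructor <;> linarith
      calc ∑ i, dist (y i) (x i) ^ 2 ≤ ∑ _i : Fin d, t ^ 2 := Finset.sum_le_sum fun i _ => h1 i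
        _ = d * t ^ 2 := by simp
        _ ≤ d * d * t ^ 2 := by gcongr; nlinarith
        _ = r ^ 2 := by rw [ht]; field_simp
    · have := hy' i
      have hxi := hxi i
      simp only [ha] at this
      simp only [Set.mem_Icc] at hxi ⊢
      split_ifs at this <;> constructor <;> linarith
  rw [measureReal_def, uniformCube, Measure.restrict_apply Metric.isClosed_closedBall.measurableSet]
  refine (ENNReal.ofReal_le_iff_le_toReal ?_).1 ?_
  · exact ((measure_mono Set.inter_subset_left).trans_lt measure_closedBall_lt_top).ne
  · rw [← hvol]
    exact measure_mono hsub

/-- The volume of the unit ball. -/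
noncomputable def unitBallVolume (d : ℕ) : ℝ := volume.real (Metric.closedBall (0 : E d) 1)

lemma volume_real_closedBall (x : E d) {r : ℝ} (hr : 0 ≤ r) :
    volume.real (Metric.closedBall x r) = r ^ d * unitBallVolume d := by
  rw [measureReal_def, Measure.addHaar_closedBall' _ _ hr, ENNReal.toReal_mul,
    ENNReal.toReal_ofReal (by positivity)]
  simp [unitBallVolume, measureReal_def]

lemma add_pow_sub_pow_le {r δ : ℝ} (hδ : 0 ≤ δ) (hr : 0 ≤ r) (h : r + δ ≤ 1) (d : ℕ) :
    (r + δ) ^ d - r ^ d ≤ d * δ := by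
  induction d with
  | zero => simp
  | succ d ih =>
    have h1 : (r + δ) ^ d ≤ 1 := pow_le_one₀ (by linarith) h
    have h2 : (r + δ) ^ (d + 1) - r ^ (d + 1) = r * ((r + δ) ^ d - r ^ d) + δ * (r + δ) ^ d := by
      ring
    have h3 : 0 ≤ (r + δ) ^ d - r ^ d := sub_nonneg.2 (pow_le_pow_left₀ hr (by linarith) d)
    rw [h2]
    push_cast
    nlinarith

lemma uniformCube_shell_le (hd : 1 ≤ d) (x : E d) {r δ : ℝ} (hδ : 0 ≤ δ) (hr : -δ ≤ r)
    (h : r + δ ≤ 1) [IsFiniteMeasure (uniformCube d)] :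
    (uniformCube d).real (Metric.closedBall x (r + δ))
      ≤ (uniformCube d).real (Metric.closedBall x r) + d * unitBallVolume d * δ := by
  have hu : 0 ≤ unitBallVolume d := measureReal_nonneg
  have hd' : (1 : ℝ) ≤ d := by exact_mod_cast hd
  have hle : ∀ S : Set (E d), volume S ≠ ⊤ → (uniformCube d).real S ≤ volume.real S := fun S hS =>
    ENNReal.toReal_mono hS (Measure.restrict_apply_le _ _)
  -- A negative `r` occurs at the first grid radius `-1 / n`. The inner ball is then empty and `(r +
  -- δ) ^ d ≤ δ` suffices.
  rcases lt_or_ge r 0 with h0 | h0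
  · calc _ ≤ volume.real (Metric.closedBall x (r + δ)) := hle _ measure_closedBall_lt_top.ne
      _ = (r + δ) ^ d * unitBallVolume d := volume_real_closedBall x (by linarith)
      _ ≤ δ * unitBallVolume d := by
        gcongr
        exact (pow_le_of_le_one (by linarith) h (by omega)).trans (by linarith)
      _ ≤ d * unitBallVolume d * δ := by nlinarith [mul_nonneg hu hδ]
      _ ≤ _ := le_add_of_nonneg_left measureReal_nonneg
  · have hsub : Metric.closedBall x r ⊆ Metric.closedBall x (r + δ) :=
      Metric.closedBall_subset_closedBall (by linarith)
    have hms : MeasurableSet (Metric.closedBall x r) := Metric.isClosed_closedBall.measurableSet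
    have h1 : (uniformCube d).real (Metric.closedBall x (r + δ) \ Metric.closedBall x r)
        = (uniformCube d).real (Metric.closedBall x (r + δ))
          - (uniformCube d).real (Metric.closedBall x r) := measureReal_sdiff hsub hms
    have h2 : volume.real (Metric.closedBall x (r + δ) \ Metric.closedBall x r)
        = volume.real (Metric.closedBall x (r + δ)) - volume.real (Metric.closedBall x r) :=
      measureReal_sdiff hsub hms measure_closedBall_lt_top.ne
    have h3 := hle (Metric.closedBall x (r + δ) \ Metric.closedBall x r)
      ((measure_mono Set.sdiff_subset).trans_lt measure_closedBall_lt_top).ne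
    rw [h2, volume_real_closedBall x h0, volume_real_closedBall x (by linarith)] at h3
    have h4 := mul_le_mul_of_nonneg_right (add_pow_sub_pow_le hδ h0 h d) hu
    rw [h1] at h3
    linarith

/-! ### Class densities and the AM-regret. -/

/-- The density of the law of `X` given `Y = m`. -/
noncomputable def classDensity {d M : ℕ} (P : Measure (E d × Fin M)) (κ : Kernel (E d) (Fin M))
    (m : Fin M) (x : E d) : ℝ :=
  posterior κ x m / classProb P m

section
variable {P : Measure (E d × Fin M)} {κ : Kernel (E d) (Fin M)} {p₀ : ℝ}

lemma measurable_posterior (m : Fin M) : Measurable fun x => posterior κ x m :=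
  (κ.measurable_coe (measurableSet_singleton m)).ennreal_toReal

lemma posterior_nonneg (x : E d) (m : Fin M) : 0 ≤ posterior κ x m := measureReal_nonneg

lemma posterior_le_one [IsMarkovKernel κ] (x : E d) (m : Fin M) : posterior κ x m ≤ 1 :=
  measureReal_le_one

lemma sum_posterior [IsMarkovKernel κ] (x : E d) : ∑ m, posterior κ x m = 1 := by
  simp [posterior]

lemma classProb_le_one [IsProbabilityMeasure P] (m : Fin M) : classProb P m ≤ 1 :=
  measureReal_le_one

lemma classDensity_nonneg (m : Fin M) (x : E d) : 0 ≤ classDensity P κ m x :=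
  div_nonneg (posterior_nonneg x m) measureReal_nonneg

lemma classDensity_le [IsMarkovKernel κ] (hp₀ : 0 < p₀) (hP : ∀ m, p₀ ≤ classProb P m)
    (m : Fin M) (x : E d) : classDensity P κ m x ≤ 1 / p₀ :=
  div_le_div₀ zero_le_one (posterior_le_one x m) hp₀ (hP m)

lemma posterior_le_classDensity [IsProbabilityMeasure P] (hp₀ : 0 < p₀)
    (hP : ∀ m, p₀ ≤ classProb P m) (m : Fin M) (x : E d) :
    posterior κ x m ≤ classDensity P κ m x :=
  le_div_self (posterior_nonneg x m) (hp₀.trans_le (hP m)) (classProb_le_one m)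

lemma integrable_classDensity [IsMarkovKernel κ] (m : Fin M) (μ : Measure (E d))
    [IsFiniteMeasure μ] : Integrable (classDensity P κ m) μ := by
  refine Integrable.div_const ?_ _
  refine Integrable.of_bound (measurable_posterior m).aestronglyMeasurable 1 (ae_of_all _ fun x => ?_)
  rw [Real.norm_of_nonneg (posterior_nonneg x m)]
  exact posterior_le_one x m

lemma classMeasure_eq [IsProbabilityMeasure P] [IsMarkovKernel κ] [P.IsCondKernel κ]
    (m : Fin M) {S : Set (E d)} (hS : MeasurableSet S) :
    classMeasure P m S = ∫ x in S, classDensity P κ m x ∂P.fst := by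
  have h1 : {p : E d × Fin M | p.1 ∈ S ∧ p.2 = m} = S ×ˢ {m} := by ext; simp
  have h2 : P (S ×ˢ {m}) = ∫⁻ x in S, κ x {m} ∂P.fst := by
    conv_lhs => rw [← P.disintegrate κ]
    exact Measure.compProd_apply_prod hS (measurableSet_singleton m)
  simp only [classDensity, posterior]
  rw [integral_div, classMeasure, h1, measureReal_def, h2]
  congr 1
  exact (integral_toReal (κ.measurable_coe (measurableSet_singleton m)).aemeasurable
    (ae_of_all _ fun x => measure_lt_top _ _)).symm

lemma classMeasure_le [IsProbabilityMeasure P] [IsMarkovKernel κ] [P.IsCondKernel κ]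
    (hp₀ : 0 < p₀) (hP : ∀ m, p₀ ≤ classProb P m)
    (m : Fin M) {S : Set (E d)} (hS : MeasurableSet S) :
    classMeasure P m S ≤ P.fst.real S / p₀ := by
  rw [classMeasure_eq (κ := κ) m hS]
  calc _ ≤ ∫ x in S, 1 / p₀ ∂P.fst :=
        integral_mono (integrable_classDensity m _) (integrable_const _)
          fun x => classDensity_le hp₀ hP m x
    _ = _ := by simp [div_eq_mul_inv]

lemma classMeasure_sub_le [IsProbabilityMeasure P] [IsMarkovKernel κ] [P.IsCondKernel κ]
    (hp₀ : 0 < p₀) (hP : ∀ m, p₀ ≤ classProb P m)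
    (m : Fin M) {S S' : Set (E d)} (hS : MeasurableSet S) (hS' : MeasurableSet S') (h : S ⊆ S') :
    classMeasure P m S' - classMeasure P m S ≤ (P.fst.real S' - P.fst.real S) / p₀ := by
  have h1 : classMeasure P m S' - classMeasure P m S = classMeasure P m (S' \ S) := by
    simp only [classMeasure_eq (κ := κ) m hS, classMeasure_eq (κ := κ) m hS',
      classMeasure_eq (κ := κ) m (hS'.diff hS)]
    rw [setIntegral_sdiff hS (integrable_classDensity m _).integrableOn h]
  rw [h1, ← measureReal_sdiff h hS]
  exact classMeasure_le (κ := κ) hp₀ hP m (hS'.diff hS)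

/-- Since `π_m ≤ 1`, each class density dominates its posterior, and the posteriors sum to one. -/
lemma le_sum_classMeasure [IsProbabilityMeasure P] [IsMarkovKernel κ] [P.IsCondKernel κ]
    (hp₀ : 0 < p₀) (hP : ∀ m, p₀ ≤ classProb P m) {S : Set (E d)} (hS : MeasurableSet S) :
    P.fst.real S ≤ ∑ m, classMeasure P m S := by
  simp only [classMeasure_eq (κ := κ) _ hS]
  rw [← integral_finsetSum _ fun m _ => integrable_classDensity m _]
  calc P.fst.real S = ∫ x in S, 1 ∂P.fst := by simp
    _ ≤ _ := integral_mono (integrable_const _)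
        (integrable_finsetSum _ fun m _ => integrable_classDensity m _) fun x => by
          show (1 : ℝ) ≤ ∑ m, classDensity P κ m x
          rw [← sum_posterior (κ := κ) x]
          exact Finset.sum_le_sum fun m _ => posterior_le_classDensity hp₀ hP m x

lemma ae_mem_cube (hU : P.fst = uniformCube d) : ∀ᵐ x ∂P.fst, x ∈ cube d := by
  rw [hU]
  exact ae_restrict_mem measurableSet_cube

/-- The bias estimate: Hölder continuity, valid at almost every point of the ball because `X` lies
in the cube, is integrated over the ball. -/
lemma abs_classMeasure_closedBall_sub_le [IsProbabilityMeasure P] [IsMarkovKernel κ]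
    [P.IsCondKernel κ] {α cL : ℝ} (hα : 0 < α) (hcL : 0 < cL)
    (hU : P.fst = uniformCube d) (hp₀ : 0 < p₀) (hP : ∀ m, p₀ ≤ classProb P m)
    (hH : HolderPosterior κ α cL) (m : Fin M) {x : E d} (hx : x ∈ cube d) {r : ℝ} (hr : 0 ≤ r) :
    |classMeasure P m (Metric.closedBall x r)
      - classDensity P κ m x * P.fst.real (Metric.closedBall x r)|
      ≤ cL * r ^ α / p₀ * P.fst.real (Metric.closedBall x r) := by
  have hS : MeasurableSet (Metric.closedBall x r) := Metric.isClosed_closedBall.measurableSet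
  have h1 : classMeasure P m (Metric.closedBall x r)
      - classDensity P κ m x * P.fst.real (Metric.closedBall x r)
      = ∫ y in Metric.closedBall x r, (classDensity P κ m y - classDensity P κ m x) ∂P.fst := by
    rw [integral_sub (integrable_classDensity m _) (integrable_const _),
      ← classMeasure_eq (κ := κ) m hS]
    simp [mul_comm]
  rw [h1, ← Real.norm_eq_abs]
  refine norm_setIntegral_le_of_norm_le_const_ae (measure_lt_top _ _) ?_
  refine (ae_restrict_iff' hS).2 ((ae_mem_cube hU).mono fun y hy hyS => ?_)
  rw [classDensity, classDensity, ← sub_div, Real.norm_eq_abs, abs_div,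
    abs_of_pos (hp₀.trans_le (hP m))]
  refine div_le_div₀ (by positivity) ((hH x hx y hy m).trans ?_) hp₀ (hP m)
  gcongr
  rwa [Metric.mem_closedBall, dist_eq_norm] at hyS

/-- Each recall integrates a class density over the region where that label is chosen, and these
regions partition the space. Classifiers can thus be compared pointwise. -/
lemma amMeasure_eq [IsProbabilityMeasure P] [IsMarkovKernel κ] [P.IsCondKernel κ]
    {f : E d → Fin M} (hf : Measurable f) :
    Integrable (fun x => classDensity P κ (f x) x) P.fst ∧
    amMeasure P f = (1 / (M : ℝ)) * ∫ x, classDensity P κ (f x) x ∂P.fst := by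
  have hfm : ∀ m, MeasurableSet {x | f x = m} := fun m => hf (measurableSet_singleton m)
  have h1 : (fun x => classDensity P κ (f x) x)
      = fun x => ∑ m, Set.indicator {x | f x = m} (classDensity P κ m) x := by
    funext x
    rw [Finset.sum_eq_single (f x)]
    · exact (Set.indicator_of_mem (by rfl) _).symm
    · intro m _ hm
      exact Set.indicator_of_notMem (fun h => hm h.symm) _
    · simp
  have h2 : ∀ m, Integrable (Set.indicator {x | f x = m} (classDensity P κ m)) P.fst := fun m =>
    (integrable_classDensity m _).indicator (hfm m)
  rw [h1]
  refine ⟨integrable_finsetSum _ fun m _ => h2 m, ?_⟩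
  rw [integral_finsetSum _ fun m _ => h2 m, amMeasure]
  congr 1
  refine Finset.sum_congr rfl fun m _ => ?_
  rw [integral_indicator (hfm m), ← classMeasure_eq m (hfm m), classRecall, classMeasure,
    measureReal_def, cond_apply (show MeasurableSet {p : E d × Fin M | p.2 = m} from
      measurable_snd (measurableSet_singleton m)), ENNReal.toReal_mul,
    ENNReal.toReal_inv, div_eq_inv_mul, classProb, measureReal_def, measureReal_def]
  congr 3
  ext p
  simp [and_comm]

end

/-- A label that is not maximal ranks second or lower, so its value is at most the second largest
one. -/
lemma orderStat_zero_sub_one_le (hM : 2 ≤ M) (v : Fin M → ℝ) {l : Fin M} {t : ℝ}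
    (hl : ∃ m, v l < v m) (ht : ∀ m, v m - v l ≤ t) :
    |orderStat v ⟨0, by omega⟩ - orderStat v ⟨1, by omega⟩| ≤ t := by
  have hmono : Monotone (v ∘ Tuple.sort v) := Tuple.monotone_sort v
  set σ := Tuple.sort v
  have h10 : orderStat v ⟨1, by omega⟩ ≤ orderStat v ⟨0, by omega⟩ :=
    hmono (by simp [Fin.le_def, Fin.rev]; omega)
  have hl1 : v l ≤ orderStat v ⟨1, by omega⟩ := by
    obtain ⟨m, hm⟩ := hl
    have h1 : σ.symm l < σ.symm m := by
      by_contra! h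
      have := hmono h
      simp only [Function.comp_apply, Equiv.apply_symm_apply] at this
      linarith
    have h2 : σ.symm l ≤ (⟨1, by omega⟩ : Fin M).rev := by
      rw [Fin.lt_def] at h1
      have := (σ.symm m).isLt
      rw [Fin.le_def, Fin.val_rev]
      simp only
      omega
    have h3 := hmono h2
    simp only [Function.comp_apply, Equiv.apply_symm_apply] at h3
    exact h3
  rw [abs_of_nonneg (sub_nonneg.2 h10)]
  have := ht (σ (⟨0, by omega⟩ : Fin M).rev)
  have h3 : orderStat v ⟨0, by omega⟩ = v (σ (⟨0, by omega⟩ : Fin M).rev) := rfl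
  linarith

/-- A classifier whose class density is within `t` of the maximal one outside a bad set has an
AM-regret controlled by the margin condition and the mass of the bad set. -/
theorem amRegret_le (hM : 2 ≤ M) {P : Measure (E d × Fin M)} [IsProbabilityMeasure P]
    {κ : Kernel (E d) (Fin M)} [IsMarkovKernel κ] [P.IsCondKernel κ] {β cβ p₀ t : ℝ}
    (hU : P.fst = uniformCube d) (hp₀ : 0 < p₀) (hP : ∀ m, p₀ ≤ classProb P m)
    (hMC : MarginCondition hM P κ β cβ) (ht : 0 < t) {B : Set (E d)} (hB : MeasurableSet B)
    {f : E d → Fin M} (hf : Measurable f)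
    (hgood : ∀ x ∈ cube d, x ∉ B → ∀ m, classDensity P κ m x - classDensity P κ (f x) x ≤ t) :
    amRegret P f ≤ t * (cβ * t ^ β) + P.fst.real B / p₀ := by
  set S : Set (E d) := {x | |orderStat (weightedPosterior P κ x) ⟨0, by omega⟩
        - orderStat (weightedPosterior P κ x) ⟨1, by omega⟩| ≤ t} with hS
  -- The measurable hull has the same mass, so measurability of the order statistics is not needed.
  have hS1 : P.fst.real (toMeasurable P.fst S) ≤ cβ * t ^ β := by
    rw [measureReal_def, measure_toMeasurable]
    exact hMC t ht
  have hSm : MeasurableSet (toMeasurable P.fst S) := measurableSet_toMeasurable _ _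
  have hpt : ∀ x ∈ cube d, ∀ l : Fin M, classDensity P κ l x - classDensity P κ (f x) x
      ≤ (toMeasurable P.fst S).indicator (fun _ => t) x + B.indicator (fun _ => 1 / p₀) x := by
    intro x hx l
    have hi1 : 0 ≤ (toMeasurable P.fst S).indicator (fun _ => t) x :=
      Set.indicator_nonneg (fun _ _ => ht.le) _
    by_cases hxB : x ∈ B
    · rw [Set.indicator_of_mem hxB]
      have := classDensity_le (κ := κ) hp₀ hP l x
      have := classDensity_nonneg (P := P) (κ := κ) (f x) x
      linarith
    · rw [Set.indicator_of_notMem hxB, add_zero]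
      by_cases hle : classDensity P κ l x ≤ classDensity P κ (f x) x
      · linarith
      · push Not at hle
        -- The normalizer of the weighted posterior is at least one, so gaps of weighted posteriors
        -- are no larger than gaps of class densities.
        have hsum : 1 ≤ ∑ j, posterior κ x j / classProb P j := by
          rw [← sum_posterior (κ := κ) x]
          exact Finset.sum_le_sum fun m _ => posterior_le_classDensity hp₀ hP m x
        have hxS : x ∈ S := by
          refine orderStat_zero_sub_one_le hM (weightedPosterior P κ x) (l := f x) ⟨l, ?_⟩ fun m => ?_
          · exact div_lt_div_of_pos_right hle (by linarith)
          · simp only [weightedPosterior]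
            rw [← sub_div]
            exact div_le_of_le_mul₀ (by linarith) ht.le
              ((hgood x hx hxB m).trans (le_mul_of_one_le_right ht.le hsum))
        rw [Set.indicator_of_mem (subset_toMeasurable _ _ hxS)]
        exact hgood x hx hxB l
  have hM1 : (1 : ℝ) ≤ M := by exact_mod_cast (by omega : 1 ≤ M)
  have hcb : 0 ≤ cβ * t ^ β := measureReal_nonneg.trans hS1
  obtain ⟨hfi, hfe⟩ := amMeasure_eq (P := P) (κ := κ) hf
  rw [amRegret, sub_le_iff_le_add]
  refine csSup_le ⟨_, f, hf, rfl⟩ ?_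
  rintro _ ⟨g, hg, rfl⟩
  obtain ⟨hgi, hge⟩ := amMeasure_eq (P := P) (κ := κ) hg
  rw [hfe, hge, ← sub_le_iff_le_add, ← mul_sub, ← integral_sub hgi hfi]
  have hR : 0 ≤ t * (cβ * t ^ β) + P.fst.real B / p₀ := by positivity
  have hI : ∫ x, (classDensity P κ (g x) x - classDensity P κ (f x) x) ∂P.fst
      ≤ t * (cβ * t ^ β) + P.fst.real B / p₀ := by
    have i1 : Integrable ((toMeasurable P.fst S).indicator fun _ => t) P.fst :=
      (integrable_const t).indicator hSm
    have i2 : Integrable (B.indicator fun _ => 1 / p₀) P.fst :=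
      (integrable_const _).indicator hB
    calc _ ≤ ∫ x, ((toMeasurable P.fst S).indicator (fun _ => t) x
          + B.indicator (fun _ => 1 / p₀) x) ∂P.fst :=
          integral_mono_ae (hgi.sub hfi) (i1.add i2)
            ((ae_mem_cube hU).mono fun x hx => hpt x hx (g x))
      _ = t * P.fst.real (toMeasurable P.fst S) + P.fst.real B / p₀ := by
          rw [integral_add i1 i2, integral_indicator_const _ hSm, integral_indicator_const _ hB]
          simp [mul_comm, div_eq_mul_inv]
      _ ≤ _ := by gcongr
  calc _ ≤ 1 / (M : ℝ) * (t * (cβ * t ^ β) + P.fst.real B / p₀) := by gcongr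
    _ ≤ _ := mul_le_of_le_one_left hR (div_le_one_of_le₀ hM1 (by positivity))

/-! ### Deviation inequalities and the good event. -/

lemma measureReal_le_of_lintegral_exp_le {Ω : Type*} [MeasurableSpace Ω] {μ : Measure Ω}
    {X : Ω → ℝ} (hX : Measurable X) {c : ℝ}
    (h : ∫⁻ ω, ENNReal.ofReal (Real.exp (X ω)) ∂μ ≤ ENNReal.ofReal (Real.exp c)) (L : ℝ) :
    μ.real {ω | L ≤ X ω} ≤ Real.exp (c - L) := by
  have h1 := mul_meas_ge_le_lintegral (μ := μ) hX.exp.ennreal_ofReal (ENNReal.ofReal (Real.exp L))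
  have h2 : {ω | ENNReal.ofReal (Real.exp L) ≤ ENNReal.ofReal (Real.exp (X ω))}
      = {ω | L ≤ X ω} := by
    ext ω
    simp [ENNReal.ofReal_le_ofReal_iff (Real.exp_pos (X ω)).le]
  rw [h2] at h1
  refine ENNReal.toReal_le_of_le_ofReal (Real.exp_pos _).le ?_
  rw [sub_eq_add_neg, Real.exp_add, Real.exp_neg, ENNReal.ofReal_mul (Real.exp_pos _).le,
    ENNReal.ofReal_inv_of_pos (Real.exp_pos L), ← div_eq_mul_inv,
    ENNReal.le_div_iff_mul_le (by simp [Real.exp_pos]) (by simp), mul_comm]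
  exact h1.trans h

section

variable (P : Measure (E d × Fin M)) [IsProbabilityMeasure P]

lemma measureReal_acceptedCount_ge (m : Fin M) (hpos : 0 < classProb P m) {S : Set (E d)}
    (hS : MeasurableSet S) (l L : ℝ) :
    (samplingLaw P n).real {ω | L ≤ l * acceptedCount ω.1 (accepted ω.2) m S
      - minorityCount ω.1 * ((Real.exp l - 1) * classMeasure P m S)} ≤ Real.exp (-L) := by
  rw [← zero_sub L]
  refine measureReal_le_of_lintegral_exp_le
    (((measurable_acceptedCount m hS).const_mul l).sub (measurable_minorityCount.mul_const _)) ?_ L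
  simpa using lintegral_exp_acceptedCount_le P m hpos hS l

/-- Two-sided deviations of the number of accepted observations from its conditional intensity. -/
lemma measureReal_acceptedCount_deviation (m : Fin M) (hpos : 0 < classProb P m) {S : Set (E d)}
    (hS : MeasurableSet S) {l : ℝ} (hl : 0 < l) (hl' : l ≤ 1) (L : ℝ) :
    (samplingLaw P n).real {ω | l * (minorityCount ω.1 * classMeasure P m S) + L / l
      < |acceptedCount ω.1 (accepted ω.2) m S - minorityCount ω.1 * classMeasure P m S|}
      ≤ 2 * Real.exp (-L) := by
  have h1 := measureReal_acceptedCount_ge (n := n) P m hpos hS l L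
  have h2 := measureReal_acceptedCount_ge (n := n) P m hpos hS (-l) L
  have hsub : {ω : (Fin n → E d × Fin M) × (Fin n → Bool) |
      l * (minorityCount ω.1 * classMeasure P m S) + L / l
      < |acceptedCount ω.1 (accepted ω.2) m S - minorityCount ω.1 * classMeasure P m S|}
      ⊆ {ω | L ≤ l * acceptedCount ω.1 (accepted ω.2) m S
      - minorityCount ω.1 * ((Real.exp l - 1) * classMeasure P m S)} ∪
      {ω | L ≤ -l * acceptedCount ω.1 (accepted ω.2) m S
      - minorityCount ω.1 * ((Real.exp (-l) - 1) * classMeasure P m S)} := by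
    intro ω hω
    have hq : 0 ≤ (minorityCount ω.1 : ℝ) * classMeasure P m S :=
      mul_nonneg (Nat.cast_nonneg _) (classMeasure_nonneg P m S)
    simp only [Set.mem_ofPred_eq, Set.mem_union] at hω ⊢
    set q := (minorityCount ω.1 : ℝ) * classMeasure P m S
    set N := (acceptedCount ω.1 (accepted ω.2) m S : ℝ)
    -- The remainder in `exp (±l) - 1 = ±l + O(l ^ 2)` is at most `l ^ 2`; divided by `l`, it is the
    -- relative error.
    have e1 := (abs_le.1 (Real.abs_exp_sub_one_sub_id_le (x := l) (by rwa [abs_of_pos hl]))).2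
    have e2 := (abs_le.1 (Real.abs_exp_sub_one_sub_id_le (x := -l)
      (by rwa [abs_neg, abs_of_pos hl]))).2
    have hL : l * (L / l) = L := by field_simp
    rcases lt_abs.1 hω with h | h
    · left
      have h3 := mul_lt_mul_of_pos_left h hl
      have h4 := mul_le_mul_of_nonneg_left e1 hq
      have h5 : (minorityCount ω.1 : ℝ) * ((Real.exp l - 1) * classMeasure P m S)
        = q * (Real.exp l - 1) := by ring
      rw [h5]
      nlinarith
    · right
      have h3 := mul_lt_mul_of_pos_left h hl
      have h4 := mul_le_mul_of_nonneg_left e2 hq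
      have h5 : (minorityCount ω.1 : ℝ) * ((Real.exp (-l) - 1) * classMeasure P m S)
        = q * (Real.exp (-l) - 1) := by ring
      rw [h5]
      nlinarith
  calc _ ≤ _ := measureReal_mono hsub
    _ ≤ _ := measureReal_union_le _ _
    _ ≤ _ := by linarith

/-- The pairs of a sample and a point such that, for some class and some ball around the point with
radius `(j-1)/n`, `j ≤ n`, the number of accepted observations deviates from its intensity. -/
def deviationSet (n : ℕ) (l L : ℝ) : Set (((Fin n → E d × Fin M) × (Fin n → Bool)) × E d) :=
  {q | ∃ j : Fin (n + 1), ∃ m, l * (minorityCount q.1.1 *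
      classMeasure P m (Metric.closedBall q.2 ((j - 1) / n))) + L / l
      < |acceptedCount q.1.1 (accepted q.1.2) m (Metric.closedBall q.2 ((j - 1) / n))
        - minorityCount q.1.1 * classMeasure P m (Metric.closedBall q.2 ((j - 1) / n))|}

omit [IsProbabilityMeasure P] in
lemma deviationSet_eq (l L : ℝ) : deviationSet P n l L = ⋃ j : Fin (n + 1), ⋃ m, {q |
    l * (minorityCount q.1.1 *
      classMeasure P m (Metric.closedBall q.2 ((j - 1) / n))) + L / l
      < |acceptedCount q.1.1 (accepted q.1.2) m (Metric.closedBall q.2 ((j - 1) / n))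
        - minorityCount q.1.1 * classMeasure P m (Metric.closedBall q.2 ((j - 1) / n))|} := by
  ext; simp [deviationSet]

lemma measurable_classMeasure_closedBall (m : Fin M) (r : ℝ) :
    Measurable fun x => classMeasure P m (Metric.closedBall x r) := by
  have hs : MeasurableSet {q : E d × (E d × Fin M) | dist q.2.1 q.1 ≤ r ∧ q.2.2 = m} :=
    MeasurableSet.inter (s₁ := {q : E d × (E d × Fin M) | dist q.2.1 q.1 ≤ r})
      (measurableSet_le (by fun_prop) measurable_const)
      ((measurable_snd.comp measurable_snd) (measurableSet_singleton m))
  exact (measurable_measure_prodMk_left (ν := P) hs).ennreal_toReal.div_const _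

lemma measurableSet_deviationSet (l L : ℝ) : MeasurableSet (deviationSet P n l L) := by
  rw [deviationSet_eq]
  refine MeasurableSet.iUnion fun j => MeasurableSet.iUnion fun m => ?_
  have hT : MeasurableSet {q : E d × E d | dist q.2 q.1 ≤ ((j : ℝ) - 1) / n} :=
    measurableSet_le (by fun_prop) measurable_const
  have h1 : Measurable fun q : ((Fin n → E d × Fin M) × (Fin n → Bool)) × E d =>
      (acceptedCount q.1.1 (accepted q.1.2) m (Metric.closedBall q.2 ((j - 1) / n)) : ℝ) := by
    simpa only [Set.mem_ofPred_eq, Metric.closedBall] using measurable_acceptedCount_of_prod (n := n) m hT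
  have h2 : Measurable fun q : ((Fin n → E d × Fin M) × (Fin n → Bool)) × E d =>
      (minorityCount q.1.1 : ℝ) * classMeasure P m (Metric.closedBall q.2 ((j - 1) / n)) :=
    (measurable_minorityCount.comp measurable_fst).mul
      ((measurable_classMeasure_closedBall P m _).comp measurable_snd)
  exact measurableSet_lt ((h2.const_mul l).add_const _) (h1.sub h2).abs

lemma measureReal_deviationSet_section_le (hpos : ∀ m, 0 < classProb P m) {l : ℝ} (hl : 0 < l)
    (hl' : l ≤ 1) (L : ℝ) (x : E d) :
    (samplingLaw P n).real {ω | (ω, x) ∈ deviationSet P n l L}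
      ≤ (n + 1) * (M * (2 * Real.exp (-L))) := by
  have : {ω | (ω, x) ∈ deviationSet P n l L} = ⋃ j : Fin (n + 1), ⋃ m,
      {ω : (Fin n → E d × Fin M) × (Fin n → Bool) | l * (minorityCount ω.1 *
      classMeasure P m (Metric.closedBall x ((j - 1) / n))) + L / l
      < |acceptedCount ω.1 (accepted ω.2) m (Metric.closedBall x ((j - 1) / n))
        - minorityCount ω.1 * classMeasure P m (Metric.closedBall x ((j - 1) / n))|} := by
    ext; simp [deviationSet]
  rw [this]
  calc _ ≤ ∑ j : Fin (n + 1), ∑ m : Fin M, (2 * Real.exp (-L)) := by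
        refine (measureReal_iUnion_fintype_le _).trans (Finset.sum_le_sum fun j _ => ?_)
        refine (measureReal_iUnion_fintype_le _).trans (Finset.sum_le_sum fun m _ => ?_)
        exact measureReal_acceptedCount_deviation P m (hpos m)
          Metric.isClosed_closedBall.measurableSet hl hl' L
    _ = _ := by simp

/-- With high probability the set of points at which some count deviates has small mass. -/
lemma measureReal_deviationSet_mass_ge (hpos : ∀ m, 0 < classProb P m) {l : ℝ} (hl : 0 < l)
    (hl' : l ≤ 1) (L : ℝ) {ε : ℝ} (hε : 0 < ε) :
    (samplingLaw P n).real {ω | ε ≤ P.fst.real {x | (ω, x) ∈ deviationSet P n l L}}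
      ≤ (n + 1) * (M * (2 * Real.exp (-L))) / ε := by
  have hB := measurableSet_deviationSet (n := n) P l L
  -- Exchanging the integrals turns the bound at each fixed point into one on the expected bad mass.
  have h1 : ∫⁻ ω, P.fst {x | (ω, x) ∈ deviationSet P n l L} ∂(samplingLaw P n)
      = ∫⁻ x, samplingLaw P n {ω | (ω, x) ∈ deviationSet P n l L} ∂P.fst := by
    have e1 := Measure.prod_apply (μ := samplingLaw P n) (ν := P.fst) hB
    have e2 := Measure.prod_apply_symm (μ := samplingLaw P n) (ν := P.fst) hB
    exact e1.symm.trans e2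
  have h2 : ∫⁻ x, samplingLaw P n {ω | (ω, x) ∈ deviationSet P n l L} ∂P.fst
      ≤ ENNReal.ofReal ((n + 1) * (M * (2 * Real.exp (-L)))) := by
    calc _ ≤ ∫⁻ _, ENNReal.ofReal ((n + 1) * (M * (2 * Real.exp (-L)))) ∂P.fst := by
          refine lintegral_mono fun x => ?_
          rw [← ofReal_measureReal]
          exact ENNReal.ofReal_le_ofReal (measureReal_deviationSet_section_le P hpos hl hl' L x)
      _ = _ := by simp
  have h3 := mul_meas_ge_le_lintegral (μ := samplingLaw P n)
    (measurable_measure_prodMk_left (ν := P.fst) hB) (ENNReal.ofReal ε)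
  have h4 : {ω | ε ≤ P.fst.real {x | (ω, x) ∈ deviationSet P n l L}}
      = {ω | ENNReal.ofReal ε ≤ P.fst (Prod.mk ω ⁻¹' deviationSet P n l L)} := by
    ext ω
    exact (ENNReal.ofReal_le_iff_le_toReal (measure_ne_top _ _)).symm
  rw [h4]
  refine ENNReal.toReal_le_of_le_ofReal (by positivity) ?_
  rw [ENNReal.ofReal_div_of_pos hε, ENNReal.le_div_iff_mul_le (by simp [hε]) (by simp), mul_comm]
  exact h3.trans (h1.trans_le h2)

lemma measureReal_classCount_lt {p₀ : ℝ} (hP : ∀ m, p₀ ≤ classProb P m) (m : Fin M) :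
    (samplingLaw P n).real {ω | (classCount ω.1 m : ℝ) < p₀ * n / 2}
      ≤ Real.exp (-(p₀ * n / 10)) := by
  have h := measureReal_le_of_lintegral_exp_le (μ := samplingLaw P n)
    (X := fun ω => -1 * (classCount ω.1 m : ℝ))
    (((measurable_of_labels fun y => (classCount (ofLabels d y) m : ℝ)).comp
      measurable_fst).const_mul (-1)) (lintegral_exp_classCount_le P m (-1)) (-(p₀ * n / 2))
  -- The exponent is then at most `(0.5 - 0.63) * p₀ * n`, below `-p₀ * n / 10`.
  have he : Real.exp (-1) ≤ 0.37 := by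
    have := Real.exp_neg_one_lt_d9
    linarith
  refine (measureReal_mono fun ω hω => ?_).trans (h.trans (Real.exp_le_exp.2 ?_))
  · simp only [Set.mem_ofPred_eq] at hω ⊢
    linarith
  · have h1 : p₀ * n ≤ classProb P m * n := by
      have := hP m
      gcongr
    have h2 : 0 ≤ classProb P m * n := mul_nonneg measureReal_nonneg (Nat.cast_nonneg n)
    nlinarith

/-- The event on which the under-sampling `k`-NN classifier is controlled. -/
theorem exists_good_event (hM : 1 ≤ M) {p₀ : ℝ} (hp₀ : 0 < p₀) (hP : ∀ m, p₀ ≤ classProb P m)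
    {l : ℝ} (hl : 0 < l) (hl' : l ≤ 1) (L : ℝ) {ε : ℝ} (hε : 0 < ε) :
    ∃ G : Set ((Fin n → E d × Fin M) × (Fin n → Bool)), MeasurableSet G ∧
      1 - ((n + 1) * (M * (2 * Real.exp (-L))) / ε + (M + 1) * Real.exp (-(p₀ * n / 10)))
        ≤ (samplingLaw P n).real G ∧
      ∀ ω ∈ G, P.fst.real {x | (ω, x) ∈ deviationSet P n l L} ≤ ε ∧
        p₀ * n / 2 ≤ minorityCount ω.1 ∧ p₀ * n / 5 ≤ (accepted ω.2).card := by
  have hpos : ∀ m, 0 < classProb P m := fun m => hp₀.trans_le (hP m)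
  have : Nonempty (Fin M) := ⟨⟨0, hM⟩⟩
  set m₀ : Fin M := ⟨0, hM⟩
  set B₁ := {ω | ε ≤ P.fst.real {x | (ω, x) ∈ deviationSet P n l L}} with hB₁
  set B₂ : Set ((Fin n → E d × Fin M) × (Fin n → Bool)) :=
    ⋃ m, {ω | (classCount ω.1 m : ℝ) < p₀ * n / 2} with hB₂
  -- One class suffices to bound the subsample size from below: off `B₂` and `B₃` it has at least
  -- `(0.63 / 2 - 0.1) * p₀ * n` accepted points.
  set B₃ : Set ((Fin n → E d × Fin M) × (Fin n → Bool)) :=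
    {ω | p₀ * n / 10 ≤ -1 * acceptedCount ω.1 (accepted ω.2) m₀ Set.univ
      - minorityCount ω.1 * ((Real.exp (-1) - 1) * classMeasure P m₀ Set.univ)} with hB₃
  have m1 : MeasurableSet B₁ := measurableSet_le measurable_const
    (measurable_measure_prodMk_left (ν := P.fst)
      (measurableSet_deviationSet (n := n) P l L)).ennreal_toReal
  have m2 : MeasurableSet B₂ := MeasurableSet.iUnion fun m => measurableSet_lt
    ((measurable_of_labels fun y => (classCount (ofLabels d y) m : ℝ)).comp measurable_fst)
    measurable_const
  have m3 : MeasurableSet B₃ := measurableSet_le measurable_const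
    (((measurable_acceptedCount m₀ .univ).const_mul _).sub (measurable_minorityCount.mul_const _))
  have e1 := measureReal_deviationSet_mass_ge (n := n) P hpos hl hl' L hε
  have e2 : (samplingLaw P n).real B₂ ≤ M * Real.exp (-(p₀ * n / 10)) :=
    (measureReal_iUnion_fintype_le _).trans
      ((Finset.sum_le_sum fun m _ => measureReal_classCount_lt P hP m).trans (by simp))
  have e3 : (samplingLaw P n).real B₃ ≤ Real.exp (-(p₀ * n / 10)) :=
    measureReal_acceptedCount_ge P m₀ (hpos m₀) .univ (-1) _
  have mB := (m1.union m2).union m3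
  refine ⟨((B₁ ∪ B₂) ∪ B₃)ᶜ, mB.compl, ?_, fun ω hω => ?_⟩
  · rw [probReal_compl_eq_one_sub mB]
    have := measureReal_union_le (μ := samplingLaw P n) (B₁ ∪ B₂) B₃
    have := measureReal_union_le (μ := samplingLaw P n) B₁ B₂
    linarith
  · simp only [Set.mem_compl_iff, Set.mem_union, not_or] at hω
    obtain ⟨⟨h1, h2⟩, h3⟩ := hω
    have h2' : p₀ * n / 2 ≤ minorityCount ω.1 := by
      obtain ⟨m, hm⟩ : ∃ m, classCount ω.1 m = minorityCount ω.1 := Nat.sInf_mem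
        (Set.range_nonempty fun m => classCount ω.1 m)
      rw [← hm]
      simp only [hB₂, Set.mem_iUnion, Set.mem_ofPred_eq, not_exists, not_lt] at h2
      exact h2 m
    refine ⟨(not_le.1 h1).le, h2', ?_⟩
    have h4 : classMeasure P m₀ Set.univ = 1 := by
      simp only [classMeasure, Set.mem_univ, true_and]
      exact div_self (hpos m₀).ne'
    simp only [hB₃, Set.mem_ofPred_eq, not_le, h4] at h3
    have h5 : (acceptedCount ω.1 (accepted ω.2) m₀ Set.univ : ℝ) ≤ (accepted ω.2).card := by
      exact_mod_cast acceptedCount_le_card _ _ _ _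
    have he : Real.exp (-1) ≤ 0.37 := by
      have := Real.exp_neg_one_lt_d9
      linarith
    have h6 : (0 : ℝ) ≤ p₀ * n := by positivity
    nlinarith

end

/-! ### The density gap at a good point. -/

/-- The constant relating the radius of the neighbourhoods to the rate. -/
noncomputable def radiusConstant (d : ℕ) (p₀ : ℝ) : ℝ := 12 * d / p₀

/-- The constant in the pointwise excess bound. -/
noncomputable def excessConstant (d M : ℕ) (α cL p₀ K c₁ : ℝ) : ℝ :=
  2 / p₀ * (2 * cL * (2 * radiusConstant d p₀) ^ α / p₀
    + d * unitBallVolume d / p₀ / (c₁ * p₀ / (4 * M)) + 2 / p₀ + 2 * K / (c₁ * p₀ / (4 * M)))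

lemma ceil_div_le (hn : 0 < n) {R : ℝ} (hR : 0 ≤ R) :
    R ≤ (⌈R * n⌉₊ : ℝ) / n ∧ ((⌈R * n⌉₊ : ℝ) - 1) / n < R := by
  have hn' : (0 : ℝ) < n := by exact_mod_cast hn
  have h1 := Nat.le_ceil (R * n)
  have h2 := Nat.ceil_lt_add_one (show 0 ≤ R * n by positivity)
  exact ⟨(le_div_iff₀ hn').2 h1, (div_lt_iff₀ hn').2 (by linarith)⟩

/-- The arithmetic behind the comparison of the counts of two labels. -/
lemma excess_le_of_counts {n p₀ K T l W v nm c₂ Cs Q₁ Δ qa qb qf Na Nf : ℝ} (hn' : 0 < n)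
    (hp₀ : 0 < p₀) (hK : 0 < K) (hc₂0 : 0 < c₂) (hCs0 : 0 ≤ Cs) (hQ₁0 : 0 ≤ Q₁)
    (hl0 : 0 < l) (hTl : 1 ≤ T * l) (hWdef : W = n * v) (hv0 : 0 ≤ v) (hW0 : 0 < W)
    (hTW : T ≤ W / c₂) (hnm0 : 0 ≤ nm) (hnmn : nm ≤ n) (hmin : p₀ * n / 2 ≤ nm)
    (hΔ0 : 0 < Δ) (hqa0 : 0 ≤ qa) (hqf0 : 0 ≤ qf) (hqa : qa ≤ v / p₀) (hqf : qf ≤ v / p₀)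
    (hNa : nm * qa * (1 - l) - K * T * l ≤ Na) (hNf : Nf ≤ nm * qf * (1 + l) + K * T * l)
    (hcmp : Na ≤ Nf) (hshell : qb - qa ≤ Cs * (1 / n) / p₀)
    (hdiff : Δ * v - Q₁ * l * v ≤ qb - qf) :
    Δ ≤ 2 / p₀ * (Q₁ + Cs / p₀ / c₂ + 2 / p₀ + 2 * K / c₂) * l := by
  -- All errors are brought to the scale `l * W`: the additive ones by `T ≤ W / c₂`, the shell, of
  -- order one after scaling by `nm`, also by `1 ≤ T * l`.
  have hmain : nm * (Δ * v) ≤ l * W * (Q₁ + Cs / p₀ / c₂ + 2 / p₀ + 2 * K / c₂) := by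
    have hvW : nm * v ≤ W := hWdef ▸ mul_le_mul_of_nonneg_right hnmn hv0
    have e1 : nm * (Q₁ * l * v) ≤ l * W * Q₁ := by
      calc nm * (Q₁ * l * v) = Q₁ * l * (nm * v) := by ring
        _ ≤ Q₁ * l * W := by gcongr
        _ = _ := by ring
    have e2 : nm * (Cs * (1 / n) / p₀) ≤ l * W * (Cs / p₀ / c₂) := by
      calc nm * (Cs * (1 / n) / p₀) ≤ n * (Cs * (1 / n) / p₀) := by gcongr
        _ = Cs / p₀ * 1 := by field_simp
        _ ≤ Cs / p₀ * (W / c₂ * l) := by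
            gcongr
            exact hTl.trans (by gcongr)
        _ = _ := by ring
    have e3 : nm * qa * l ≤ l * W * (1 / p₀) := by
      calc nm * qa * l ≤ n * (v / p₀) * l := by
            gcongr
        _ = _ := by rw [hWdef]; ring
    have e4 : nm * qf * l ≤ l * W * (1 / p₀) := by
      calc nm * qf * l ≤ n * (v / p₀) * l := by
            gcongr
        _ = _ := by rw [hWdef]; ring
    have e5 : K * T * l ≤ l * W * (K / c₂) := by
      calc K * T * l ≤ K * (W / c₂) * l := by gcongr
        _ = _ := by ring
    have e6 := mul_le_mul_of_nonneg_left hdiff hnm0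
    have e7 := mul_le_mul_of_nonneg_left hshell hnm0
    have e8 : l * W * (Q₁ + Cs / p₀ / c₂ + 2 / p₀ + 2 * K / c₂) = l * W * Q₁
      + l * W * (Cs / p₀ / c₂) + 2 * (l * W * (1 / p₀)) + 2 * (l * W * (K / c₂)) := by ring
    rw [e8]
    linarith
  have hfin : p₀ / 2 * W * Δ ≤ l * W * (Q₁ + Cs / p₀ / c₂ + 2 / p₀ + 2 * K / c₂) := by
    refine le_trans ?_ hmain
    calc p₀ / 2 * W * Δ = p₀ * n / 2 * (Δ * v) := by rw [hWdef]; ring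
      _ ≤ _ := mul_le_mul_of_nonneg_right hmin (mul_nonneg hΔ0.le hv0)
  refine le_of_mul_le_mul_left ?_ (show 0 < p₀ / 2 * W by positivity)
  refine hfin.trans (le_of_eq ?_)
  field_simp

set_option maxHeartbeats 1000000 in
/-- If the counts of accepted observations in the balls around `x` are close to their intensities,
the label chosen by the nearest neighbour classifier almost maximizes the class density at `x`. -/
theorem classDensity_sub_le_of_counts {P : Measure (E d × Fin M)} [IsProbabilityMeasure P]
    {κ : Kernel (E d) (Fin M)} [IsMarkovKernel κ] [P.IsCondKernel κ]
    {α cL p₀ K c₁ ρ T l : ℝ} (hd : 1 ≤ d) (hα : 0 < α) (hcL : 0 < cL)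
    (hU : P.fst = uniformCube d) (hp₀ : 0 < p₀) (hp₀' : p₀ ≤ 1) (hP : ∀ m, p₀ ≤ classProb P m)
    (hH : HolderPosterior κ α cL) (hK : 0 < K) (hc₁ : 0 < c₁)
    (hn : 2 ≤ n) (hρ : 0 < ρ) (hT : T = n * ρ ^ d) (hl : l = ρ ^ α) (hl2 : l ≤ 1 / 2)
    (hTl : 1 ≤ T * l) (hMK : M * K * l ≤ 1) (hMK' : M * K * l ≤ c₁ / 2)
    (hA : 2 * radiusConstant d p₀ * ρ ≤ 1 / 4) (hnρ : 1 / (n : ℝ) ≤ ρ)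
    {D : Fin n → E d × Fin M} {A : Finset (Fin n)} {k : ℕ} {f : E d → Fin M}
    (hk : 1 ≤ k) (hk₁ : c₁ * T ≤ k) (hk₂ : (k : ℝ) ≤ 2 * T)
    (hf : IsKNNClassifier D A k f) (hmin : p₀ * n / 2 ≤ minorityCount D)
    {x : E d} (hx : x ∈ cube d)
    (hdev : ∀ j : ℕ, j ≤ n → ∀ m, |(acceptedCount D A m (Metric.closedBall x ((j - 1) / n)) : ℝ)
        - minorityCount D * classMeasure P m (Metric.closedBall x ((j - 1) / n))|
        ≤ l * (minorityCount D * classMeasure P m (Metric.closedBall x ((j - 1) / n)))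
          + K * T * l) (m : Fin M) :
    classDensity P κ m x - classDensity P κ (f x) x ≤ excessConstant d M α cL p₀ K c₁ * l := by
  have hd' : (1 : ℝ) ≤ d := by exact_mod_cast hd
  have hn' : (0 : ℝ) < n := by exact_mod_cast (by omega : 0 < n)
  have hM : (0 : ℝ) < M := by exact_mod_cast m.pos
  have hl0 : 0 < l := hl ▸ Real.rpow_pos_of_pos hρ α
  have hT0 : 0 < T := by rw [hT]; positivity
  have hUf : IsFiniteMeasure (uniformCube d) := hU ▸ inferInstance
  have hball : ∀ r, MeasurableSet (Metric.closedBall x r) := fun r =>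
    Metric.isClosed_closedBall.measurableSet
  set a := radiusConstant d p₀ with ha
  have ha1 : 1 ≤ a := by
    rw [ha, radiusConstant, le_div_iff₀ hp₀]
    linarith
  set nm := (minorityCount D : ℝ) with hnm
  have hnm0 : 0 ≤ nm := Nat.cast_nonneg _
  have hnmn : nm ≤ n := by
    rw [hnm]
    exact_mod_cast (minorityCount_le_classCount D m).trans (classCount_le D m)
  set N : Fin M → ℝ → ℝ := fun m r => acceptedCount D A m (Metric.closedBall x r) with hN
  set q : Fin M → ℝ → ℝ := fun m r => classMeasure P m (Metric.closedBall x r) with hq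
  set v : ℝ → ℝ := fun r => P.fst.real (Metric.closedBall x r) with hv
  have hv0 : ∀ r, 0 ≤ v r := fun r => measureReal_nonneg
  have hqv : ∀ m r, q m r ≤ v r / p₀ := fun m r => classMeasure_le (κ := κ) hp₀ hP m (hball r)
  have hsq : ∀ r, v r ≤ ∑ m, q m r := fun r => le_sum_classMeasure (κ := κ) hp₀ hP (hball r)
  have hlow : ∀ j : ℕ, j ≤ n → ∀ m, nm * q m ((j - 1) / n) * (1 - l) - K * T * l
      ≤ N m ((j - 1) / n) := by
    intro j hj m
    have h := (abs_le.1 (hdev j hj m)).1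
    simp only [hN, hq]
    linarith
  have hup : ∀ j : ℕ, j ≤ n → ∀ m, N m ((j - 1) / n)
      ≤ nm * q m ((j - 1) / n) * (1 + l) + K * T * l := by
    intro j hj m
    have h := (abs_le.1 (hdev j hj m)).2
    simp only [hN, hq]
    linarith
  have hcast : ∀ i : ℕ, (((i + 1 : ℕ) : ℝ) - 1) / n = i / n := fun i => by push_cast; ring
  -- a ball of radius of order `ρ` contains `k` accepted observations
  set i₀ := ⌈a * ρ * n⌉₊ with hi₀
  obtain ⟨hr1, hr2⟩ := ceil_div_le (n := n) (R := a * ρ) (by omega) (by positivity)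
  rw [← hi₀] at hr1 hr2
  have hr3 : (i₀ : ℝ) / n ≤ 2 * a * ρ := by
    rw [sub_div] at hr2
    nlinarith
  have hi₀n : i₀ + 1 ≤ n := by
    have h1 : (i₀ : ℝ) ≤ 1 / 4 * n := (div_le_iff₀ hn').1 (hr3.trans hA)
    have h2 : (2 : ℝ) ≤ n := by exact_mod_cast hn
    have h3 : (i₀ : ℝ) + 1 ≤ n := by linarith
    exact_mod_cast h3
  have hvlow : 12 / p₀ * ρ ^ d ≤ v (i₀ / n) := by
    have h1 := le_uniformCube_closedBall hd hx (r := (i₀ : ℝ) / n) (by positivity) (by linarith)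
    simp only [hv, hU]
    refine le_trans ?_ h1
    calc 12 / p₀ * ρ ^ d ≤ (12 / p₀) ^ d * ρ ^ d := by
          gcongr
          refine le_self_pow₀ ?_ (by omega)
          rw [le_div_iff₀ hp₀]
          linarith
      _ = (a * ρ / d) ^ d := by
          rw [← mul_pow, ha, radiusConstant]
          congr 1
          field_simp
      _ ≤ _ := by gcongr
  have hkcount : k ≤ ∑ m, acceptedCount D A m (Metric.closedBall x (i₀ / n)) := by
    have h1 : ∑ m, (nm * q m (i₀ / n) * (1 - l) - K * T * l) ≤ ∑ m, N m (i₀ / n) :=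
      Finset.sum_le_sum fun m _ => by simpa only [hcast] using hlow (i₀ + 1) hi₀n m
    rw [Finset.sum_sub_distrib, ← Finset.sum_mul, ← Finset.mul_sum] at h1
    simp only [Finset.sum_const, Finset.card_univ, Fintype.card_fin, nsmul_eq_mul] at h1
    -- The factor 12 in `radiusConstant` yields total intensity `6 * T`; `1 - l` at worst halves it
    -- and the additive errors cost `T`, which leaves `2 * T ≥ k`.
    have h2 : p₀ * n / 2 * (12 / p₀ * ρ ^ d) ≤ nm * ∑ m, q m (i₀ / n) :=
      mul_le_mul hmin (hvlow.trans (hsq _)) (by positivity) hnm0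
    have h3 : p₀ * n / 2 * (12 / p₀ * ρ ^ d) = 6 * T := by rw [hT]; field_simp; norm_num
    have h4 : (M : ℝ) * (K * T * l) ≤ T := by
      calc (M : ℝ) * (K * T * l) = T * (M * K * l) := by ring
        _ ≤ T * 1 := by gcongr
        _ = T := mul_one T
    have h5 : 6 * T * (1 / 2) ≤ (nm * ∑ m, q m (i₀ / n)) * (1 - l) :=
      mul_le_mul (h3 ▸ h2) (by linarith) (by norm_num) (by linarith)
    have h6 : (k : ℝ) ≤ ∑ m, N m (i₀ / n) := by linarith
    simp only [hN] at h6
    exact_mod_cast h6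
  obtain ⟨σ, hσ, hmax⟩ := hf.2 x
  obtain ⟨R, hR0, hRr, hkR, hcnt⟩ := exists_neighbor_radius hσ hk hkcount
  -- the grid radii around the distance to the `k`-th neighbour
  set i := ⌈R * n⌉₊ with hi
  obtain ⟨hb1, hb2⟩ := ceil_div_le (n := n) (by omega) hR0
  rw [← hi] at hb1 hb2
  have hii : i ≤ i₀ := by
    refine Nat.ceil_le.2 ?_
    rwa [le_div_iff₀ hn'] at hRr
  set b := (i : ℝ) / n with hb
  have hb0 : 0 ≤ b := by positivity
  have hbr : b ≤ 2 * a * ρ := by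
    refine le_trans ?_ hr3
    rw [hb]
    gcongr
  -- Grid index `i` carries the radius just below `R`, index `i + 1` the radius `b ≥ R`. For `R = 0`
  -- the former is `-1 / n`, which is why the grid starts there.
  have hab : ((i : ℝ) - 1) / n + 1 / n = b := by rw [hb]; ring
  have hsub1 : Metric.closedBall x (((i : ℝ) - 1) / n) ⊆ Metric.closedBall x b :=
    Metric.closedBall_subset_closedBall (by rw [← hab]; linarith [one_div_pos.2 hn'])
  have hNb : ∀ m, N m b ≤ nm * q m b * (1 + l) + K * T * l := fun m => by
    simpa only [hcast] using hup (i + 1) (by omega) m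
  -- The ball holds `k ≥ c₁ * T` accepted points, so its mass is at least of order `T / n`. This
  -- lets the additive error `K * T * l` count as a relative one.
  have hW : c₁ * p₀ / (4 * M) * T ≤ n * v b := by
    have h1 : (k : ℝ) ≤ ∑ m, N m b := by
      have : k ≤ ∑ m, acceptedCount D A m (Metric.closedBall x b) :=
        hkR.trans (Finset.sum_le_sum fun m _ =>
          acceptedCount_mono D A m (Metric.closedBall_subset_closedBall hb1))
      simp only [hN]
      exact_mod_cast this
    have h2 : ∑ m, N m b ≤ ∑ _m : Fin M, (2 * (n * (v b / p₀)) + K * T * l) := by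
      refine Finset.sum_le_sum fun m _ => (hNb m).trans ?_
      have h3 : nm * q m b ≤ n * (v b / p₀) :=
        mul_le_mul hnmn (hqv m b) (classMeasure_nonneg _ _ _) hn'.le
      have h4 : 0 ≤ nm * q m b := mul_nonneg hnm0 (classMeasure_nonneg _ _ _)
      nlinarith
    simp only [Finset.sum_const, Finset.card_univ, Fintype.card_fin, nsmul_eq_mul] at h2
    have h4 : (M : ℝ) * (K * T * l) ≤ c₁ / 2 * T := by
      calc (M : ℝ) * (K * T * l) = M * K * l * T := by ring
        _ ≤ _ := by gcongr
    have h5 : c₁ / 2 * T ≤ M * (2 * (n * (v b / p₀))) := by linarith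
    calc c₁ * p₀ / (4 * M) * T = (c₁ / 2 * T) * (p₀ / (2 * M)) := by field_simp; norm_num
      _ ≤ M * (2 * (n * (v b / p₀))) * (p₀ / (2 * M)) := by gcongr
      _ = n * v b := by field_simp
  set c₂ := c₁ * p₀ / (4 * M) with hc₂
  have hc₂0 : 0 < c₂ := by positivity
  set W := n * v b with hWdef
  have hW0 : 0 < W := (mul_pos hc₂0 hT0).trans_le hW
  have hTW : T ≤ W / c₂ := by rw [le_div_iff₀ hc₂0]; linarith
  set Δ := classDensity P κ m x - classDensity P κ (f x) x with hΔ
  have hCs0 : 0 ≤ d * unitBallVolume d := mul_nonneg (by linarith) measureReal_nonneg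
  set Cs := d * unitBallVolume d with hCs
  -- comparison of the counts of the two labels
  have hcmp : N m (((i : ℝ) - 1) / n) ≤ N (f x) b := by
    have h1 : (acceptedCount D A m (Metric.closedBall x (((i : ℝ) - 1) / n)) : ℝ)
        ≤ acceptedCount D A m (Metric.ball x R) := by
      exact_mod_cast acceptedCount_mono D A m (Metric.closedBall_subset_ball hb2)
    have h2 : (acceptedCount D A (f x) (Metric.closedBall x R) : ℝ)
        ≤ acceptedCount D A (f x) (Metric.closedBall x b) := by
      exact_mod_cast acceptedCount_mono D A (f x) (Metric.closedBall_subset_closedBall hb1)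
    have h3 : (k : ℝ) * posteriorEstimate D A σ k m ≤ k * posteriorEstimate D A σ k (f x) :=
      mul_le_mul_of_nonneg_left (hmax m) (Nat.cast_nonneg k)
    exact h1.trans ((hcnt m).1.trans (h3.trans ((hcnt (f x)).2.trans h2)))
  have hshell : q m b - q m (((i : ℝ) - 1) / n) ≤ Cs * (1 / n) / p₀ := by
    refine (classMeasure_sub_le (κ := κ) hp₀ hP m (hball _) (hball _) hsub1).trans ?_
    gcongr
    have h1 := uniformCube_shell_le hd x (r := ((i : ℝ) - 1) / n) (δ := 1 / n) (by positivity)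
      (by rw [← neg_div]; gcongr; linarith [(Nat.cast_nonneg i : (0 : ℝ) ≤ i)])
      (by rw [hab]; linarith)
    rw [hab] at h1
    rw [hU]
    linarith
  have hq1 := abs_le.1 (abs_classMeasure_closedBall_sub_le hα hcL hU hp₀ hP hH m hx hb0)
  have hq2 := abs_le.1 (abs_classMeasure_closedBall_sub_le hα hcL hU hp₀ hP hH (f x) hx hb0)
  have hbα : b ^ α ≤ (2 * a) ^ α * l := by
    rw [hl, ← Real.mul_rpow (by positivity) hρ.le]
    exact Real.rpow_le_rpow hb0 hbr hα.le
  set Q₁ := 2 * cL * (2 * a) ^ α / p₀ with hQ₁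
  have hQ₁0 : 0 ≤ Q₁ := by positivity
  have hdiff : Δ * v b - Q₁ * l * v b ≤ q m b - q (f x) b := by
    have h1 : cL * b ^ α / p₀ * v b ≤ cL * ((2 * a) ^ α * l) / p₀ * v b := by
      have := hv0 b
      gcongr
    have h2 : Q₁ * l * v b = 2 * (cL * ((2 * a) ^ α * l) / p₀ * v b) := by rw [hQ₁]; ring
    have h3 := hq1.1
    have h4 := hq2.2
    have h5 : Δ * v b = classDensity P κ m x * v b - classDensity P κ (f x) x * v b := by
      rw [hΔ]; ring
    simp only [hq, hv] at h1 h2 h5 ⊢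
    linarith
  -- The sign matters because `nm` is replaced by its lower bound in the product with `Δ`.
  rcases le_or_gt Δ 0 with hΔ0 | hΔ0
  · refine hΔ0.trans (mul_nonneg ?_ hl0.le)
    rw [excessConstant]
    have : 0 ≤ unitBallVolume d := measureReal_nonneg
    positivity
  have hNa := hlow i (by omega) m
  have hNf := hNb (f x)
  have hqa : q m (((i : ℝ) - 1) / n) ≤ v b / p₀ := by
    refine (hqv m _).trans ?_
    have : v (((i : ℝ) - 1) / n) ≤ v b := measureReal_mono hsub1
    gcongr
  have hqf := hqv (f x) b
  exact excess_le_of_counts hn' hp₀ hK hc₂0 hCs0 hQ₁0 hl0 hTl hWdef (hv0 b) hW0 hTW hnm0 hnmn hmin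
    hΔ0 (classMeasure_nonneg _ _ _) (classMeasure_nonneg _ _ _) hqa hqf hNa hNf hcmp hshell hdiff

/-! ### Asymptotics of the rate and of the number of neighbours. -/

open Filter Topology

lemma neighborNumber_eq {α : ℝ} (hα : 0 < α) (hn : 1 ≤ n) :
    neighborNumber d α n = n * ((Real.log n / n) ^ (1 / (2 * α + d))) ^ d := by
  have hn' : (0 : ℝ) < n := by exact_mod_cast hn
  have he : 0 < 2 * α + d := by positivity
  have hlog : 0 ≤ Real.log n := Real.log_natCast_nonneg n
  rw [neighborNumber, ← Real.rpow_natCast, ← Real.rpow_mul (by positivity),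
    Real.div_rpow hlog hn'.le, one_div_mul_eq_div, show 2 * α / (2 * α + d) = 1 - d / (2 * α + d) by
      field_simp; ring, Real.rpow_sub hn', Real.rpow_one]
  ring

/-- The balance of bias and noise: `ρ` is chosen so that `ρ ^ (d + 2α) = log n / n`. -/
lemma mul_rate_sq {α : ℝ} (hα : 0 < α) (hn : 1 ≤ n) :
    n * ((Real.log n / n) ^ (1 / (2 * α + d))) ^ d
      * (((Real.log n / n) ^ (1 / (2 * α + d))) ^ α) ^ 2 = Real.log n := by
  have hn' : (0 : ℝ) < n := by exact_mod_cast hn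
  have he : 0 < 2 * α + d := by positivity
  have hlog : 0 ≤ Real.log n := Real.log_natCast_nonneg n
  have hx : 0 ≤ Real.log n / n := by positivity
  set ρ := (Real.log n / n) ^ (1 / (2 * α + d)) with hρ
  have hρ0 : 0 ≤ ρ := Real.rpow_nonneg hx _
  have h1 : ρ ^ d * (ρ ^ α) ^ 2 = Real.log n / n := by
    rw [← Real.rpow_natCast ρ d, ← Real.rpow_natCast (ρ ^ α) 2, ← Real.rpow_mul hρ0,
      ← Real.rpow_add_of_nonneg hρ0 (by positivity) (by positivity), hρ, ← Real.rpow_mul hx]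
    rw [show 1 / (2 * α + d) * (d + α * (2 : ℕ)) = 1 by push_cast; field_simp; ring, Real.rpow_one]
  rw [mul_assoc, h1]
  field_simp

lemma tendsto_log_div : Tendsto (fun n : ℕ => Real.log n / n) atTop (𝓝 0) := by
  have := (Real.isLittleO_log_id_atTop.tendsto_div_nhds_zero).comp
    (tendsto_natCast_atTop_atTop (R := ℝ))
  simpa [Function.comp_def] using this

lemma tendsto_log_div_rpow {a : ℝ} (ha : 0 < a) :
    Tendsto (fun n : ℕ => (Real.log n / n) ^ a) atTop (𝓝 0) := by
  have := tendsto_log_div.rpow_const (p := a) (Or.inr ha.le)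
  rwa [Real.zero_rpow ha.ne'] at this

lemma neighborNumber_mono {α : ℝ} (hα : 0 < α) {s : ℕ} (h : s ≤ n) :
    neighborNumber d α s ≤ neighborNumber d α n := by
  have hs : (s : ℝ) ≤ n := by exact_mod_cast h
  have he : 0 < 2 * α + d := by positivity
  rcases Nat.eq_zero_or_pos s with h0 | h0
  · have h1 : (0 : ℝ) ^ (2 * α / (2 * α + d)) = 0 := Real.zero_rpow (by positivity)
    rw [h0, neighborNumber, Nat.cast_zero, h1, zero_mul, neighborNumber]
    have := Real.log_natCast_nonneg n
    positivity
  · have hlog := Real.log_natCast_nonneg s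
    have h1 : Real.log s ≤ Real.log n := Real.log_le_log (by exact_mod_cast h0) hs
    unfold neighborNumber
    gcongr

/-- Since `s ≥ √n`, the logarithm loses at most a factor two, so a subsample of linear size changes
the number of neighbours only by a constant. -/
lemma le_neighborNumber {α b : ℝ} (hα : 0 < α) (hb : 0 < b) {s : ℕ} (hn : 1 ≤ n)
    (h : b * n ≤ s) (hs : Real.sqrt n ≤ b * n) :
    b ^ (2 * α / (2 * α + d)) * (1 / 2) ^ ((d : ℝ) / (2 * α + d)) * neighborNumber d α n
      ≤ neighborNumber d α s := by
  have hn' : (0 : ℝ) < n := by exact_mod_cast hn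
  have he : 0 < 2 * α + d := by positivity
  have hlog := Real.log_natCast_nonneg n
  have h1 : 1 / 2 * Real.log n ≤ Real.log s := by
    rw [one_div_mul_eq_div, ← Real.log_sqrt hn'.le]
    exact Real.log_le_log (Real.sqrt_pos.2 hn') (hs.trans h)
  calc _ = (b * n) ^ (2 * α / (2 * α + d)) * (1 / 2 * Real.log n) ^ ((d : ℝ) / (2 * α + d)) := by
        rw [neighborNumber, Real.mul_rpow hb.le hn'.le, Real.mul_rpow (by norm_num) hlog]
        ring
    _ ≤ _ := by
        unfold neighborNumber
        gcongr

lemma excessConstant_pos {α cL p₀ K c₁ : ℝ} (hM : 1 ≤ M) (hcL : 0 < cL) (hp₀ : 0 < p₀)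
    (hK : 0 < K) (hc₁ : 0 < c₁) : 0 < excessConstant d M α cL p₀ K c₁ := by
  have h1 : 0 ≤ unitBallVolume d := measureReal_nonneg
  have h2 : 0 ≤ radiusConstant d p₀ := by unfold radiusConstant; positivity
  have h3 : (0 : ℝ) < M := by exact_mod_cast hM
  unfold excessConstant
  positivity

/-- The failure probability of the good event is at most `4 / n ^ 2`. -/
lemma failure_probability_le {p₀ e : ℝ} (hp₀ : 0 < p₀) (hn : 1 ≤ n) (h4M : 4 * M ≤ n)
    (hbig : 6000 * (M + 1) / p₀ ^ 3 ≤ n) :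
    ((n : ℝ) + 1) * (M * (2 * Real.exp (-((e + 4) * Real.log n)))) / (n : ℝ) ^ (-e)
      + (M + 1) * Real.exp (-(p₀ * n / 10)) ≤ 4 / (n : ℝ) ^ 2 := by
  have hn' : (0 : ℝ) < n := by exact_mod_cast hn
  have h1n : (1 : ℝ) ≤ n := by exact_mod_cast hn
  have h4 : 4 * (M : ℝ) ≤ n := by exact_mod_cast h4M
  -- The factor `n ^ (-e)` cancels the level used in Markov's inequality. Of the four further
  -- powers, two absorb `(n + 1) * 2M ≤ n ^ 2`.
  have h1 : Real.exp (-((e + 4) * Real.log n)) = (n : ℝ) ^ (-e) * ((n : ℝ) ^ 4)⁻¹ := by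
    rw [← Real.rpow_natCast, ← Real.rpow_neg hn'.le, ← Real.rpow_add hn', Real.rpow_def_of_pos hn']
    congr 1
    push_cast
    ring
  have hpos : 0 < (n : ℝ) ^ (-e) := Real.rpow_pos_of_pos hn' _
  have h2 : ((n : ℝ) + 1) * (M * (2 * Real.exp (-((e + 4) * Real.log n)))) / (n : ℝ) ^ (-e)
      ≤ 1 / (n : ℝ) ^ 2 := by
    rw [h1]
    calc _ = ((n : ℝ) + 1) * (M * 2) / (n : ℝ) ^ 4 := by field_simp
      _ ≤ (n : ℝ) ^ 2 / (n : ℝ) ^ 4 := by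
          gcongr
          nlinarith [(Nat.cast_nonneg M : (0 : ℝ) ≤ M)]
      _ = _ := by field_simp
  have h3 : (M + 1) * Real.exp (-(p₀ * n / 10)) ≤ 1 / (n : ℝ) ^ 2 := by
    -- The cubic Taylor term is enough; `6 * 10 ^ 3` is the 6000 of the hypothesis.
    have h5 : (p₀ * n / 10) ^ 3 / 6 ≤ Real.exp (p₀ * n / 10) := by
      simpa [Nat.factorial] using Real.pow_div_factorial_le_exp (x := p₀ * n / 10) (by positivity) 3
    rw [Real.exp_neg, ← div_eq_mul_inv, div_le_div_iff₀ (Real.exp_pos _) (by positivity), one_mul]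
    refine le_trans ?_ h5
    rw [div_le_iff₀ (by positivity)] at hbig
    calc ((M : ℝ) + 1) * (n : ℝ) ^ 2 = 6000 * (M + 1) * (n : ℝ) ^ 2 / 6000 := by ring
      _ ≤ n * p₀ ^ 3 * (n : ℝ) ^ 2 / 6000 := by gcongr
      _ = _ := by ring
  calc _ ≤ 1 / (n : ℝ) ^ 2 + 1 / (n : ℝ) ^ 2 := add_le_add h2 h3
    _ ≤ 4 / (n : ℝ) ^ 2 := by rw [← add_div]; gcongr; norm_num

end UnderSampling
-- Choice of constants and conclusion.
open UnderSampling

set_option maxHeartbeats 1000000 in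
theorem theorem1 (d M : ℕ) (hd : 1 ≤ d) (hM : 2 ≤ M) (α β cL cβ p₀ : ℝ)
    (hα : 0 < α) (hβ : 0 < β) (hcL : 0 < cL) (hcβ : 0 < cβ) (hp₀ : 0 < p₀) :
    ∃ c : ℝ, 0 < c ∧ ∃ N : ℕ,
      ∀ (P : Measure (E d × Fin M)) [IsProbabilityMeasure P]
        (κ : Kernel (E d) (Fin M)) [IsMarkovKernel κ] [P.IsCondKernel κ],
        P.fst = uniformCube d →
        (∀ m, p₀ ≤ classProb P m) →
        HolderPosterior κ α cL →
        MarginCondition hM P κ β cβ →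
        ∀ k : ℕ → ℕ, (∀ s, |(k s : ℝ) - neighborNumber d α s| < 1) →
        ∀ n : ℕ, N ≤ n →
          ∃ G : Set ((Fin n → E d × Fin M) × (Fin n → Bool)), MeasurableSet G ∧
            1 - 4 / (n : ℝ) ^ 2 ≤ (samplingLaw P n).real G ∧
            ∀ ω ∈ G, ∀ f : E d → Fin M,
              IsKNNClassifier ω.1 (accepted ω.2) (k (accepted ω.2).card) f →
              amRegret P f ≤
                c * (Real.log n / n) ^ (α * (β + 1) / (2 * α + d)) := by
  have hd' : (1 : ℝ) ≤ d := by exact_mod_cast hd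
  have hM' : (2 : ℝ) ≤ M := by exact_mod_cast hM
  have he : 0 < 2 * α + d := by positivity
  set e := α * (β + 1) / (2 * α + d) with he_def
  have he0 : 0 < e := by positivity
  set K := e + 4 with hK_def
  have hK : 0 < K := by positivity
  -- The base `p₀ / 5` is the guaranteed accepted fraction, and the powered `1 / 2` comes from `log
  -- s ≥ log n / 2`. The final halving absorbs the rounding of `k`.
  set c₁ := (p₀ / 5) ^ (2 * α / (2 * α + d)) * (1 / 2) ^ ((d : ℝ) / (2 * α + d)) / 2 with hc₁_def
  have hc₁ : 0 < c₁ := by positivity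
  set C := excessConstant d M α cL p₀ K c₁ with hC_def
  have hC : 0 < C := excessConstant_pos (by omega) hcL hp₀ hK hc₁
  have ha : 0 < radiusConstant d p₀ := by unfold radiusConstant; positivity
  have hMK : 0 < M * K := by positivity
  refine ⟨C * (cβ * C ^ β) + 1 / p₀, by positivity, ?_⟩
  -- the rate along `n`
  have t1 := (Filter.Tendsto.rpow_const (p := α) (tendsto_log_div_rpow (one_div_pos.2 he))
    (Or.inr hα.le))
  rw [Real.zero_rpow hα.ne'] at t1
  have ev1 : ∀ᶠ n : ℕ in Filter.atTop, ((Real.log n / n) ^ (1 / (2 * α + d))) ^ α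
      ≤ min (min (1 / 2) c₁) (min (1 / (M * K)) (c₁ / 2 / (M * K))) :=
    t1.eventually_le_const (by positivity)
  have ev2 : ∀ᶠ n : ℕ in Filter.atTop, (Real.log n / n) ^ (1 / (2 * α + d))
      ≤ 1 / 4 / (2 * radiusConstant d p₀) :=
    (tendsto_log_div_rpow (one_div_pos.2 he)).eventually_le_const (by positivity)
  have ev3 : ∀ᶠ n : ℕ in Filter.atTop,
      max (max 3 (4 * (M : ℝ))) (max (6000 * (M + 1) / p₀ ^ 3) ((5 / p₀) ^ 2)) ≤ n :=
    tendsto_natCast_atTop_atTop.eventually_ge_atTop _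
  obtain ⟨N, hN⟩ := Filter.eventually_atTop.1 (ev1.and (ev2.and ev3))
  refine ⟨N, fun P _ κ _ _ hU hP hH hMC k hk n hn => ?_⟩
  obtain ⟨h1, h2, h3⟩ := hN n hn
  simp only [le_min_iff, max_le_iff] at h1 h3
  obtain ⟨⟨hl2, hlc⟩, hl3, hl4⟩ := h1
  obtain ⟨⟨hn3, hn4⟩, hn5, hn6⟩ := h3
  have hn3' : 3 ≤ n := by exact_mod_cast hn3
  have hn0 : (0 : ℝ) < n := by linarith
  have hlog1 : 1 ≤ Real.log n := by
    rw [Real.le_log_iff_exp_le hn0]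
    linarith [Real.exp_one_lt_d9]
  have hx0 : 0 < Real.log n / n := by positivity
  have hT2 := neighborNumber_eq (d := d) hα (show 1 ≤ n by omega)
  have hTl2 := mul_rate_sq (d := d) hα (show 1 ≤ n by omega)
  set ρ := (Real.log n / n) ^ (1 / (2 * α + d)) with hρ_def
  have hρ : 0 < ρ := Real.rpow_pos_of_pos hx0 _
  set l := ρ ^ α with hl_def
  have hl : 0 < l := Real.rpow_pos_of_pos hρ _
  set T := n * ρ ^ d with hT_def
  have hT : 0 < T := by positivity
  have hTl : 1 ≤ T * l := by
    have h4 : T * l ^ 2 ≤ T * l := by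
      rw [sq]
      exact mul_le_mul_of_nonneg_left (mul_le_of_le_one_left hl.le (by linarith)) hT.le
    linarith
  have hT1 : 1 ≤ T := by nlinarith
  have hcT : 1 ≤ c₁ * T := by
    rw [mul_comm]
    exact hTl.trans (by gcongr)
  have hMKl : M * K * l ≤ 1 := by
    rw [le_div_iff₀ hMK] at hl3
    linarith
  have hMKl' : M * K * l ≤ c₁ / 2 := by
    rw [le_div_iff₀ hMK] at hl4
    linarith
  have hA : 2 * radiusConstant d p₀ * ρ ≤ 1 / 4 := by
    rw [le_div_iff₀ (by positivity)] at h2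
    linarith
  -- The mesh is finer than the scale `ρ`, because `2 * α + d ≥ 1` and `log n ≥ 1`.
  have hnρ : 1 / (n : ℝ) ≤ ρ := by
    have h4 : 1 / (n : ℝ) ≤ (1 / (n : ℝ)) ^ (1 / (2 * α + d)) := by
      refine Real.self_le_rpow_of_le_one (by positivity) ?_ ?_
      · rw [div_le_one hn0]; linarith
      · rw [div_le_one he]; linarith
    refine h4.trans (Real.rpow_le_rpow (by positivity) (by gcongr) (by positivity))
  have hp₀' : p₀ ≤ 1 := (hP ⟨0, by omega⟩).trans (classProb_le_one _)
  obtain ⟨G, hG, hGP, hGω⟩ := exists_good_event (n := n) P (by omega) hp₀ hP hl (by linarith)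
    (K * Real.log n) (Real.rpow_pos_of_pos hn0 (-e))
  refine ⟨G, hG, ?_, fun ω hω f hf => ?_⟩
  · have := failure_probability_le (M := M) (e := e) hp₀ (show 1 ≤ n by omega)
      (by exact_mod_cast hn4) hn5
    linarith
  obtain ⟨hB, hmin, hs⟩ := hGω ω hω
  set s := (accepted ω.2).card with hs_def
  have hsn : s ≤ n := (Finset.card_le_univ _).trans (by simp)
  have hsqrt : Real.sqrt n ≤ p₀ / 5 * n := by
    refine Real.sqrt_le_iff.2 ⟨by positivity, ?_⟩
    have : 1 ≤ (p₀ / 5) ^ 2 * n := by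
      calc (1 : ℝ) = (p₀ / 5) ^ 2 * (5 / p₀) ^ 2 := by field_simp
        _ ≤ _ := by gcongr
    calc (n : ℝ) ≤ (p₀ / 5) ^ 2 * n * n := le_mul_of_one_le_left hn0.le this
      _ = _ := by ring
  have hlow := le_neighborNumber (d := d) hα (show 0 < p₀ / 5 by positivity) (s := s)
    (show 1 ≤ n by omega) (by linarith) hsqrt
  have hupp := neighborNumber_mono (d := d) hα hsn
  rw [hT2] at hlow hupp
  have hks := abs_lt.1 (hk s)
  have hlow' : 2 * (c₁ * T) ≤ neighborNumber d α s := by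
    refine le_trans (le_of_eq ?_) hlow
    rw [hc₁_def]; ring
  have hk₁ : c₁ * T ≤ k s := by linarith [hks.1]
  have hk₂ : (k s : ℝ) ≤ 2 * T := by linarith [hks.2]
  have hk1 : 1 ≤ k s := by
    have : (1 : ℝ) ≤ k s := hcT.trans hk₁
    exact_mod_cast this
  -- The identity `T * l ^ 2 = log n` converts Chernoff's additive term to the form used at good
  -- points.
  have hLl : K * Real.log n / l = K * T * l := by
    rw [← hTl2]
    field_simp
  have hBm : MeasurableSet {x | (ω, x) ∈ deviationSet P n l (K * Real.log n)} :=
    measurable_prodMk_left (measurableSet_deviationSet P l (K * Real.log n))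
  have hreg := amRegret_le hM hU hp₀ hP hMC (t := C * l) (by positivity) hBm hf.1
    fun x hx hxB m => classDensity_sub_le_of_counts hd hα hcL hU hp₀ hp₀' hP hH hK hc₁
      (by omega) hρ hT_def hl_def hl2 hTl hMKl hMKl' hA hnρ hk1 hk₁ hk₂ hf hmin hx
      (fun j hj m' => by
        rw [← hLl]
        by_contra! hcon
        exact hxB ⟨⟨j, by omega⟩, m', hcon⟩) m
  refine hreg.trans ?_
  have hrate : l * l ^ β = (Real.log n / n) ^ e := by
    rw [hl_def, ← Real.rpow_mul hρ.le, ← Real.rpow_add hρ, hρ_def, ← Real.rpow_mul hx0.le, he_def]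
    congr 1
    field_simp
    ring
  have hε : (n : ℝ) ^ (-e) ≤ (Real.log n / n) ^ e := by
    rw [Real.rpow_neg hn0.le, ← Real.inv_rpow hn0.le]
    refine Real.rpow_le_rpow (by positivity) ?_ he0.le
    rw [inv_eq_one_div]
    gcongr
  calc C * l * (cβ * (C * l) ^ β)
        + P.fst.real {x | (ω, x) ∈ deviationSet P n l (K * Real.log n)} / p₀
      ≤ C * l * (cβ * (C * l) ^ β) + (Real.log n / n) ^ e / p₀ := by
        have := hB.trans hε
        gcongr
    _ = (C * (cβ * C ^ β) + 1 / p₀) * (Real.log n / n) ^ e := by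
        rw [← hrate, Real.mul_rpow hC.le hl.le]
        ring
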